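/- **Setting.** Let $d\in\{2,3\}$, let $D\subset\mathbb R^d$ be open and bounded, let $a>0$, and let $D_s=\{x\in D:\operatorname{dist}(x,\mathbb R^d\setminus D)>a\}$, $D_c=D\setminus D_s$ (a boundary layer of thickness $a$). Let $L^2_0$ be the space of square integrable fields $D\to\mathbb R^d$ that vanish on $D_c$, extended by zero outside $D$. Let $\rho,T>0$. Let $f:[0,\infty)\to\mathbb R$ be smooth, concave, positive on $(0,\infty)$, with $\lim_{r\to0^+}f(r)/r=f'(0)>0$ and $\lim_{r\to\infty}f(r)$ finite, and let $\overline r>0$ be the inflection point of $r\mapsto f(r^2)$ (convex on $[0,\overline r]$, concave on $[\overline r,\infty)$). Let $J:[0,\infty)\to[0,\infty)$ be measurable, bounded, zero on $[1,\infty)$, with $m=\int_{|\xi|<1}|\xi|J(|\xi|)\,d\xi>0$. For $\epsilon>0$ let $\mathcal H_\epsilon(x)$ be the open ball of radius $\epsilon$ about $x$, $V_d$ its volume, and put $$\mathcal S(y,x)=\frac{u(y)-u(x)}{|y-x|}\cdot\frac{y-x}{|y-x|},\qquad \mathcal W^\epsilon(\mathcal S,y-x)=\frac1\epsilon J\!\left(\frac{|y-x|}\epsilon\right)\frac{f(|y-x|\mathcal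 S^2)}{|y-x|},$$ $$\nabla PD^\epsilon(u)(x)=-\frac2{V_d}\int_{\mathcal H_\epsilon(x)}\partial_{\mathcal S}\mathcal W^\epsilon(\mathcal S,y-x)\frac{y-x}{|y-x|}\,dy .$$ Let $b\in C^1([0,T];L^2_0)$ and $u_0,v_0\in L^2_0$, where $u_0$ has finite energy of linear elastic fracture mechanics: there is a Borel set $K_0\subset D$ with $\mathcal H^{d-1}(K_0)<\infty$ such that the distributional strain $\frac12(\nabla u_0+\nabla u_0^T)$ in $D$ is the sum of a field in $L^2(D)$ and of a part $g\,\mathcal H^{d-1}|_{K_0}$ with $g$ integrable. Let $\epsilon_k=2^{-k}$, $k=1,2,\dots$, and let $u^{\epsilon_k}:[0,T]\to L^2_0$ be such that, for every $k\ge1$ with $2\epsilon_k<a$, $u^{\epsilon_k}\in C^2([0,T];L^2_0)$ is the cohesive evolution of horizon $\epsilon_k$, that is, for all $t\in[0,T]$, $$\rho\,u^{\epsilon_k}_{tt}=-\nabla PD^{\epsilon_k}(u^{\epsilon_k})+b\ \text{ a.e. in } D_s,\qquad u^{\epsilon_k}(0)=u_0,\quad u^{\epsilon_k}_t(0)=v_0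 .$$ Let $\mathcal S^{\epsilon_k}(t,y,x)$ be the strain of $u^{\epsilon_k}(t)$. For $B\subset\mathcal H_\epsilon(x)$ let $P(B)=\frac1{\epsilon^dm}\int_B\frac{|y-x|}\epsilon J\!\left(\frac{|y-x|}\epsilon\right)dy$. For $0<\underline k\le\overline r$, $\frac12\le\alpha<1$, $0<\overline\theta\le1$ and $t\in[0,T]$, the process zone $PZ^{\epsilon_k}(t)$ is the set of all $x\in D$ with $P(\{y\in\mathcal H_{\epsilon_k}(x):|\mathcal S^{\epsilon_k}(t,y,x)|>\underline k|y-x|^{\alpha-1}\})>\overline\theta$. For $\delta>0$ let $CPZ^\delta(t)=\bigcup_{k\ge1,\ \epsilon_k<\delta}PZ^{\epsilon_k}(t)$, and let $CPZ^0(t)=\bigcap_{\delta>0}CPZ^\delta(t)$. Let $\mathcal L^d$ denote Lebesgue measure and put $\beta=2\alpha-1\in[0,1)$. **Theorem (localization of the process zone in the small horizon limit).** For all such $\underline k,\alpha,\overline\theta$: 1. for every $t\in[0,T]$, $CPZ^\delta(t)\subset CPZ^{\delta'}(t)$ whenever $0<\delta\le\delta'$; 2. there is a constant $K>0$, independent of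 $t$ and $\delta$, such that $\mathcal L^d(CPZ^\delta(t))\le K\delta^{1-\beta}$ for all $t\in[0,T]$ and all $\delta>0$; 3. for every $t\in[0,T]$, $\mathcal L^d(CPZ^0(t))=\lim_{\delta\to0^+}\mathcal L^d(CPZ^\delta(t))=0$; 4. for every $t\in[0,T]$, for almost every $x\in D$ there is $\delta>0$ such that $P(\{y\in\mathcal H_{\epsilon_k}(x):|\mathcal S^{\epsilon_k}(t,y,x)|\le\underline k|y-x|^{\alpha-1}\})\ge1-\overline\theta$ for all $k\ge1$ with $\epsilon_k<\delta$; moreover $\mathcal L^d(D\setminus CPZ^0(t))=\mathcal L^d(D)$. -/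

import Mathlib

open Set Filter Topology MeasureTheory
open scoped ENNReal ContDiff RealInnerProductSpace

noncomputable section

namespace CohesiveDynamics

/-- The ambient Euclidean space `ℝᵈ`. -/
abbrev Space (d : ℕ) : Type := EuclideanSpace ℝ (Fin d)

/-- Square integrable vector fields on `ℝᵈ` (modulo almost everywhere equality). -/
abbrev L2Field (d : ℕ) : Type := Lp (Space d) 2 (volume : Measure (Space d))

/-! ### The body and its displacement space -/

/-- The interior part `D_s` of the body `D`: what remains of `D` once the boundary layer
`D_c` of thickness `a` (the constraint set) has been removed. -/
def interiorPart {d : ℕ} (D : Set (Space d)) (a : ℝ) : Set (Space d) :=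
  {x | x ∈ D ∧ a < Metric.infDist x Dᶜ}

/-- The space `L²₀(D; ℝᵈ)` of square integrable fields on `D` that vanish on the constraint set.
Its elements are regarded as fields on `ℝᵈ`, extended by zero outside `D`; thus they vanish
almost everywhere off the interior part of `D`. -/
def L20 {d : ℕ} (D : Set (Space d)) (a : ℝ) : Submodule ℝ (L2Field d) where
  carrier := {w | ∀ᵐ x, x ∉ interiorPart D a → w x = 0}
  zero_mem' := by
    filter_upwards [Lp.coeFn_zero (Space d) 2 (volume : Measure (Space d))] with x hx _
    simp
  add_mem' := by
    intro v w hv hw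
    filter_upwards [hv, hw, Lp.coeFn_add v w] with x h1 h2 h3 hx
    rw [h3, Pi.add_apply, h1 hx, h2 hx, add_zero]
  smul_mem' := by
    intro c w hw
    filter_upwards [hw, Lp.coeFn_smul c w] with x h1 h2 hx
    rw [h2, Pi.smul_apply, h1 hx, smul_zero]

/-- The field `ℝᵈ → ℝᵈ` underlying an element of `L²₀(D; ℝᵈ)`. -/
def toField {d : ℕ} {D : Set (Space d)} {a : ℝ} (w : L20 D a) : Space d → Space d :=
  fun x => (w : L2Field d) x

/-! ### The constitutive law -/

/-- The class of potential functions `f : [0, ∞) → ℝ`: positive, smooth, concave, with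
`lim_{r → 0+} f r / r = f' 0 > 0` and a finite limit at infinity. -/
structure IsCohesivePotential (f : ℝ → ℝ) : Prop where
  smooth : ContDiffOn ℝ ∞ f (Ici 0)
  pos : ∀ r, 0 < r → 0 < f r
  concave : ConcaveOn ℝ (Ici 0) f
  slope_pos : 0 < derivWithin f (Ici 0) 0
  tendsto_slope : Tendsto (fun r => f r / r) (𝓝[>] 0) (𝓝 (derivWithin f (Ici 0) 0))
  tendsto_top : ∃ fInf : ℝ, Tendsto f atTop (𝓝 fInf)

/-- `rBar` is the inflection point of `r ↦ f (r²)` on `[0, ∞)`, where this function changes from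
convex to concave. -/
structure IsInflectionPoint (f : ℝ → ℝ) (rBar : ℝ) : Prop where
  pos : 0 < rBar
  convex : ConvexOn ℝ (Icc 0 rBar) (fun r => f (r ^ 2))
  concave : ConcaveOn ℝ (Ici rBar) (fun r => f (r ^ 2))

/-- The constant `m = ∫_{|ξ| < 1} |ξ| J(|ξ|) dξ`. -/
def influenceMass (d : ℕ) (J : ℝ → ℝ) : ℝ :=
  ∫ ξ in Metric.ball (0 : Space d) 1, ‖ξ‖ * J ‖ξ‖

/-- Influence functions `J`: measurable, nonnegative and bounded on `[0, 1)`, zero on `[1, ∞)`, and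
not negligible (so that one can normalize by `m`). The influence function for the horizon `ε` is
`r ↦ J (r / ε)`. -/
structure IsInfluenceFunction (d : ℕ) (J : ℝ → ℝ) : Prop where
  measurable : Measurable J
  nonneg : ∀ r ∈ Ico (0 : ℝ) 1, 0 ≤ J r
  bounded : ∃ M : ℝ, ∀ r ∈ Ico (0 : ℝ) 1, J r < M
  eq_zero : ∀ r, 1 ≤ r → J r = 0
  mass_pos : 0 < influenceMass d J

/-- The linearized strain `S = (w(y) - w(x)) / |y - x| · e` with `e = (y - x) / |y - x|`. -/
def bondStrain {d : ℕ} (w : Space d → Space d) (y x : Space d) : ℝ :=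
  ⟪‖y - x‖⁻¹ • (w y - w x), ‖y - x‖⁻¹ • (y - x)⟫

/-- The potential per unit length of a bond of length `r` under the strain `S`. -/
def bondPotential (f J : ℝ → ℝ) (ε S r : ℝ) : ℝ :=
  1 / ε * J (r / ε) * (1 / r * f (r * S ^ 2))

/-- The force per unit length in a bond of length `r`: the derivative of the potential with
respect to the strain. -/
def bondForce (f J : ℝ → ℝ) (ε S r : ℝ) : ℝ :=
  deriv (fun s => bondPotential f J ε s r) S

/-- The gradient of the peridynamic energy,
`-(2 / V_d) ∫_{|y - x| < ε} ∂_S W(S, y - x) (y - x) / |y - x| dy`, where `V_d` is the volume of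
the ball of radius `ε`. -/
def gradPD {d : ℕ} (f J : ℝ → ℝ) (ε : ℝ) (w : Space d → Space d) (x : Space d) : Space d :=
  -((2 / volume.real (Metric.ball x ε)) •
    ∫ y in Metric.ball x ε,
      bondForce f J ε (bondStrain w y x) ‖y - x‖ • (‖y - x‖⁻¹ • (y - x)))

/-! ### Initial data and evolutions -/

/-- The partial derivative `∂φ/∂xⱼ`. -/
def partialDeriv {d : ℕ} (φ : Space d → ℝ) (j : Fin d) (x : Space d) : ℝ :=
  fderiv ℝ φ x (EuclideanSpace.single j 1)

/-- The displacement `w` has finite energy of linear elastic fracture mechanics in `D`: there is a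
crack set `K ⊆ D` of finite `(d-1)`-dimensional Hausdorff measure, and the distributional strain
`(∇w + ∇wᵀ) / 2` in `D` is the sum of a square integrable field `e` (the bulk strain) and of a part
carried by `K` with an integrable density `g` with respect to the `(d-1)`-dimensional Hausdorff
measure (for a field of special bounded deformation, `K` is the jump set and `g` is the symmetrized
product of the jump with the normal). -/
def HasFiniteLEFMEnergy {d : ℕ} (D : Set (Space d)) (w : Space d → Space d) : Prop :=
  ∃ (e g : Space d → Matrix (Fin d) (Fin d) ℝ) (K : Set (Space d)),
    (∀ i j, MemLp (fun x => e x i j) 2 (volume.restrict D)) ∧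
    MeasurableSet K ∧ K ⊆ D ∧
    Measure.hausdorffMeasure ((d : ℝ) - 1) K < ⊤ ∧
    (∀ i j, IntegrableOn (fun x => g x i j) K (Measure.hausdorffMeasure ((d : ℝ) - 1))) ∧
    ∀ φ : Space d → ℝ, ContDiff ℝ ∞ φ → HasCompactSupport φ → tsupport φ ⊆ D →
      ∀ i j : Fin d,
        ∫ x in D, (w x i * partialDeriv φ j x + w x j * partialDeriv φ i x) / 2 =
          -(∫ x in D, e x i j * φ x) -
            ∫ x in K, g x i j * φ x ∂(Measure.hausdorffMeasure ((d : ℝ) - 1))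

/-- `u ∈ C²([0,T]; L²₀(D; ℝᵈ))` solves the initial value problem of cohesive dynamics with horizon
`ε`: `ρ u_tt = -∇PD^ε(u) + b` in the interior part of the body, for all times in `[0,T]`, with
`u(0) = u₀` and `u_t(0) = v₀`. -/
structure IsCohesiveEvolution {d : ℕ} (D : Set (Space d)) (a ρ T : ℝ) (f J : ℝ → ℝ)
    (b : ℝ → L20 D a) (u₀ v₀ : L20 D a) (ε : ℝ) (u : ℝ → L20 D a) : Prop where
  contDiffOn : ContDiffOn ℝ 2 u (Icc 0 T)
  initial_displacement : u 0 = u₀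
  initial_velocity : derivWithin u (Icc 0 T) 0 = v₀
  motion : ∀ t ∈ Icc 0 T, ∀ᵐ x ∂(volume.restrict (interiorPart D a)),
    ρ • toField (iteratedDerivWithin 2 u (Icc 0 T) t) x =
      -gradPD f J ε (toField (u t)) x + toField (b t) x

/-! ### The process zone -/

/-- The weighted volume fraction `P(B)` of a subset `B` of the neighborhood of `x` of radius `ε`. -/
def weightedFraction {d : ℕ} (J : ℝ → ℝ) (ε : ℝ) (x : Space d) (B : Set (Space d)) : ℝ :=
  1 / (ε ^ d * influenceMass d J) * ∫ y in B, ‖y - x‖ / ε * J (‖y - x‖ / ε)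

/-- The points `y` of the neighborhood of `x` for which the strain exceeds `κ |y - x|^(α-1)`. -/
def highStrain {d : ℕ} (ε κ α : ℝ) (w : Space d → Space d) (x : Space d) : Set (Space d) :=
  {y | y ∈ Metric.ball x ε ∧ κ * ‖y - x‖ ^ (α - 1) < |bondStrain w y x|}

/-- The points `y` of the neighborhood of `x` for which the strain is at most `κ |y - x|^(α-1)`. -/
def controlledStrain {d : ℕ} (ε κ α : ℝ) (w : Space d → Space d) (x : Space d) :
    Set (Space d) :=
  {y | y ∈ Metric.ball x ε ∧ |bondStrain w y x| ≤ κ * ‖y - x‖ ^ (α - 1)}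

/-- The process zone of a displacement `w`. -/
def processZone {d : ℕ} (D : Set (Space d)) (J : ℝ → ℝ) (ε κ α θ : ℝ)
    (w : Space d → Space d) : Set (Space d) :=
  {x | x ∈ D ∧ θ < weightedFraction J ε x (highStrain ε κ α w x)}

/-- The horizons `ε_k = 2^{-k}`. -/
def horizon (k : ℕ) : ℝ := 1 / 2 ^ k

/-- `CPZ^δ`: the union of the process zones of `w k` for the horizons `ε_k < δ`, `k = 1, 2, …`. -/
def CPZ {d : ℕ} (D : Set (Space d)) (J : ℝ → ℝ) (κ α θ : ℝ)
    (w : ℕ → Space d → Space d) (δ : ℝ) : Set (Space d) :=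
  {x | ∃ k : ℕ, 1 ≤ k ∧ horizon k < δ ∧ x ∈ processZone D J (horizon k) κ α θ (w k)}

/-- `CPZ^0`, the intersection of all `CPZ^δ` with `δ > 0`. -/
def CPZzero {d : ℕ} (D : Set (Space d)) (J : ℝ → ℝ) (κ α θ : ℝ)
    (w : ℕ → Space d → Space d) : Set (Space d) :=
  {x | ∀ δ : ℝ, 0 < δ → x ∈ CPZ D J κ α θ w δ}

/-- The centers `x ∈ D` for which there is `δ > 0` such that, for all `ε_k < δ`, the strain is
controlled on a fraction at least `1 - θ` of the neighborhood of `x` of radius `ε_k`. -/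
def controlledCenters {d : ℕ} (D : Set (Space d)) (J : ℝ → ℝ) (κ α θ : ℝ)
    (w : ℕ → Space d → Space d) : Set (Space d) :=
  {x | x ∈ D ∧ ∃ δ : ℝ, 0 < δ ∧ ∀ k : ℕ, 1 ≤ k → horizon k < δ →
    1 - θ ≤ weightedFraction J (horizon k) x (controlledStrain (horizon k) κ α (w k) x)}

end CohesiveDynamics

end

open CohesiveDynamics

noncomputable section

namespace CohesiveDynamics

/-! ### Properties of the potential function -/

/-! Everything rests on a bound for the peridynamic energy (`pdEnergy` divided by the volume of the
horizon ball) that is uniform in time and in the horizon.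

Given such a bound, Markov's inequality controls a single process zone. On a bond of length `r < ε`
with strain above `κ r^(α-1)`, concavity and `f 0 = 0` make the energy density at least `f (κ²)
ε^(2α-2)` times the weight that defines `P` (`weight_le_bondEnergy`). A point of the zone therefore
carries energy of order at least `ε^d ε^(2α-2)`, and the zone has volume `O(ε^(2-2α))`
(`volume_processZone_le`). The exponent `2 - 2α = 1 - β` is positive and the horizons are geometric,
so the union over `ε_k < δ` has volume `O(δ^(1-β))` (`volume_CPZ_le`), and the limit set is null.

The energy is propagated in time by Gronwall's inequality (`pdEnergy_le_gronwallBound`).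
Differentiability of the energy is not needed: the tangent inequality for the concave `f` makes it
semiconcave (`pdEnergy_le`), and this one-sided estimate bounds the right difference quotients of
the total energy by the power of `b`. The remainder has a constant depending on the horizon, but it
is quadratic and disappears in the limit.

The energy at time zero is estimated one bond vector `z` at a time
(`exists_lintegral_potential_le`). Unless the segment from `x` to `x + z` meets the crack, the
difference of `⟪u₀, z⟫` is a line integral of the bulk strain, and `f r ≤ f'(0) r` with Jensen's
inequality gives a contribution `O(‖z‖)`. The exceptional `x` form the set swept by the crack along
`-z`, of volume `O(‖z‖)` (`volume_sweep_le`), where `f` is merely bounded. Integration over `z` then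
gives a bound free of `ε` (`exists_pdEnergy_le`). -/

/-- The derivative of the potential function on `[0, ∞)`. -/
def potentialSlope (f : ℝ → ℝ) (r : ℝ) : ℝ := derivWithin f (Ici 0) r

namespace IsCohesivePotential

variable {f : ℝ → ℝ} (hf : IsCohesivePotential f)
include hf

theorem hasDerivWithinAt {r : ℝ} (hr : 0 ≤ r) :
    HasDerivWithinAt f (potentialSlope f r) (Ici 0) r :=
  ((hf.smooth.differentiableOn (by simp)) r hr).hasDerivWithinAt

theorem continuousOn : ContinuousOn f (Ici 0) := hf.smooth.continuousOn

/-- Near zero `f r = (f r / r) * r`, a product of a convergent factor and one that tends to zero. -/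
theorem map_zero : f 0 = 0 := by
  have h1 : Tendsto f (𝓝[>] 0) (𝓝 (f 0)) :=
    (hf.continuousOn 0 self_mem_Ici).mono_left (nhdsWithin_mono _ Ioi_subset_Ici_self)
  have h2 : Tendsto (fun r : ℝ => f r / r * r) (𝓝[>] 0)
      (𝓝 (derivWithin f (Ici 0) 0 * 0)) :=
    hf.tendsto_slope.mul (tendsto_id.mono_left nhdsWithin_le_nhds)
  rw [mul_zero] at h2
  refine tendsto_nhds_unique h1 (h2.congr' ?_)
  filter_upwards [self_mem_nhdsWithin] with r hr
  exact div_mul_cancel₀ _ (ne_of_gt hr)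

theorem nonneg {r : ℝ} (hr : 0 ≤ r) : 0 ≤ f r := by
  rcases hr.eq_or_lt with rfl | h
  · exact hf.map_zero.ge
  · exact (hf.pos r h).le

theorem mul_le {t r : ℝ} (ht : 0 ≤ t) (ht1 : t ≤ 1) (hr : 0 ≤ r) : t * f r ≤ f (t * r) := by
  have := hf.concave.2 (x := r) hr (y := 0) self_mem_Ici ht (sub_nonneg.2 ht1) (by ring)
  simpa [hf.map_zero] using this

/-- Tangent form of concavity. The sign, monotonicity and Lipschitz bounds below come from it, and
so does the semiconcavity of the energy. -/
theorem tangent {x y : ℝ} (hx : 0 ≤ x) (hy : 0 ≤ y) :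
    f y ≤ f x + potentialSlope f x * (y - x) := by
  rcases lt_trichotomy x y with h | rfl | h
  · have := ConcaveOn.slope_le_of_hasDerivWithinAt hf.concave hx hy h
      (hf.hasDerivWithinAt hx)
    rw [slope_def_field, div_le_iff₀ (by linarith)] at this
    linarith
  · simp
  · have := ConcaveOn.le_slope_of_hasDerivWithinAt hf.concave hy hx h
      (hf.hasDerivWithinAt hx)
    rw [slope_def_field, le_div_iff₀ (by linarith)] at this
    linarith

theorem slope_nonneg {x : ℝ} (hx : 0 ≤ x) : 0 ≤ potentialSlope f x := by
  by_contra! h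
  obtain ⟨y, hy0, hy⟩ : ∃ y, 0 ≤ y ∧ f x + potentialSlope f x * (y - x) < 0 := by
    -- The point where the tangent line at `x` takes the value `-1`.
    refine ⟨x + (f x + 1) / (-potentialSlope f x), ?_, ?_⟩
    · have := hf.nonneg hx
      have : 0 ≤ (f x + 1) / (-potentialSlope f x) := by
        apply div_nonneg <;> linarith
      linarith
    · have : potentialSlope f x * ((f x + 1) / (-potentialSlope f x)) = -(f x + 1) := by
        rw [div_neg, mul_neg, mul_div_cancel₀ _ h.ne]
      rw [add_sub_cancel_left, this]
      linarith
  linarith [hf.tangent hx hy0, hf.nonneg hy0]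

theorem monotoneOn : MonotoneOn f (Ici 0) := by
  intro x hx y hy hxy
  have := hf.tangent (x := y) (y := x) hy hx
  nlinarith [hf.slope_nonneg hy]

theorem exists_bound : ∃ N : ℝ, 0 < N ∧ ∀ r, 0 ≤ r → f r ≤ N := by
  obtain ⟨L, hL⟩ := hf.tendsto_top
  have key : ∀ r, 0 ≤ r → f r ≤ L := by
    intro r hr
    refine ge_of_tendsto hL ?_
    filter_upwards [eventually_ge_atTop r] with y hy
    exact hf.monotoneOn hr (hr.trans hy) hy
  exact ⟨L, (hf.pos 1 one_pos).trans_le (key 1 zero_le_one), key⟩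

theorem slope_zero_pos : 0 < potentialSlope f 0 := hf.slope_pos

theorem le_slope_mul {r : ℝ} (hr : 0 ≤ r) : f r ≤ potentialSlope f 0 * r := by
  simpa [hf.map_zero] using hf.tangent le_rfl hr

theorem slope_le {x : ℝ} (hx : 0 ≤ x) : potentialSlope f x ≤ potentialSlope f 0 := by
  rcases hx.eq_or_lt with rfl | h
  · exact le_rfl
  have h1 := hf.tangent le_rfl hx
  have h2 := hf.tangent hx le_rfl
  nlinarith

theorem abs_sub_le {x y : ℝ} (hx : 0 ≤ x) (hy : 0 ≤ y) :
    |f y - f x| ≤ potentialSlope f 0 * |y - x| := by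
  wlog h : x ≤ y generalizing x y
  · rw [abs_sub_comm, abs_sub_comm y]
    exact this hy hx (le_of_not_ge h)
  rw [abs_of_nonneg (sub_nonneg.2 (hf.monotoneOn hx hy h)), abs_of_nonneg (sub_nonneg.2 h)]
  nlinarith [hf.tangent hx hy, hf.slope_le hx]

theorem measurable_comp {α : Type*} [MeasurableSpace α] {g : α → ℝ} (hg : Measurable g)
    (h0 : ∀ x, 0 ≤ g x) : Measurable fun x => f (g x) := by
  -- Regularity of `f` is known on the half-line only; the even extension is continuous on `ℝ`.
  have h : Measurable fun r => f |r| :=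
    (hf.continuousOn.comp_continuous continuous_abs fun r => abs_nonneg r).measurable
  simpa only [Function.comp_def, abs_of_nonneg (h0 _)] using h.comp hg

theorem measurable_slope_comp {α : Type*} [MeasurableSpace α] {g : α → ℝ} (hg : Measurable g)
    (h0 : ∀ x, 0 ≤ g x) : Measurable fun x => potentialSlope f (g x) := by
  have hc : ContinuousOn (potentialSlope f) (Ici 0) :=
    hf.smooth.continuousOn_derivWithin (uniqueDiffOn_Ici 0) (by simp)
  have h : Measurable fun r => potentialSlope f |r| :=
    (hc.comp_continuous continuous_abs fun r => abs_nonneg r).measurable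
  simpa only [Function.comp_def, abs_of_nonneg (h0 _)] using h.comp hg

/-- The side condition covers the degenerate bond: at `r = 0` the convention `1 / 0 = 0` makes the
force vanish, as does the right-hand side once `S = 0`. -/
theorem bondForce_eq (J : ℝ → ℝ) (ε S : ℝ) {r : ℝ} (hr : 0 ≤ r) (hS : r = 0 → S = 0) :
    bondForce f J ε S r = 1 / ε * J (r / ε) * (2 * S * potentialSlope f (r * S ^ 2)) := by
  rcases hr.eq_or_lt with rfl | h
  · simp [bondForce, bondPotential, hS rfl]
  have h1 : HasDerivAt (fun s : ℝ => r * s ^ 2) (r * (2 * S)) S := by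
    simpa using (hasDerivAt_pow 2 S).const_mul r
  have h2 : HasDerivAt (fun s : ℝ => f (r * s ^ 2)) (potentialSlope f (r * S ^ 2) * (r * (2 * S)))
      S := by
    have := (hf.hasDerivWithinAt (r := r * S ^ 2) (by positivity)).comp S
      (h1.hasDerivWithinAt (s := univ)) (fun s _ => mem_Ici.2 (by positivity))
    simpa [Function.comp_def, hasDerivWithinAt_univ] using this
  rw [bondForce]
  simp only [bondPotential]
  rw [((h2.const_mul (1 / r)).const_mul (1 / ε * J (r / ε))).deriv]
  field_simp

end IsCohesivePotential

/-! ### The peridynamic energy -/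

theorem IsInfluenceFunction.exists_bound {d : ℕ} {J : ℝ → ℝ} (hJ : IsInfluenceFunction d J) :
    ∃ M : ℝ, 0 < M ∧ ∀ r, 0 ≤ r → 0 ≤ J r ∧ J r ≤ M := by
  obtain ⟨M, hM⟩ := hJ.bounded
  have hM0 : 0 < M := (hJ.nonneg 0 (by simp)).trans_lt (hM 0 (by simp))
  refine ⟨M, hM0, fun r hr => ?_⟩
  rcases lt_or_ge r 1 with h | h
  · exact ⟨hJ.nonneg r ⟨hr, h⟩, (hM r ⟨hr, h⟩).le⟩
  · simp [hJ.eq_zero r h, hM0.le]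

/-- The kernel `|z|⁻¹`, cut off outside the ball of radius `ε`. -/
def invKernel {d : ℕ} (ε : ℝ) (z : Space d) : ℝ :=
  (Metric.ball (0 : Space d) ε).indicator (fun z => ‖z‖⁻¹) z

theorem invKernel_nonneg {d : ℕ} (ε : ℝ) (z : Space d) : 0 ≤ invKernel ε z :=
  indicator_nonneg (fun z _ => inv_nonneg.2 (norm_nonneg z)) z

theorem invKernel_neg {d : ℕ} (ε : ℝ) (z : Space d) : invKernel ε (-z) = invKernel ε z := by
  simp [invKernel, indicator]

theorem invKernel_eq {d : ℕ} {ε : ℝ} {z : Space d} (h : ‖z‖ < ε) : invKernel ε z = ‖z‖⁻¹ := by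
  simp [invKernel, indicator, h]

/-- In polar coordinates the integrand is `r^(d-1) r⁻¹ = r^(d-2)`. This kernel dominates energy
densities and bond forces. -/
theorem integrable_invKernel {d : ℕ} (hd : 2 ≤ d) (ε : ℝ) :
    Integrable (invKernel ε : Space d → ℝ) := by
  have : Nontrivial (Space d) := by
    have : Nonempty (Fin d) := ⟨⟨0, by omega⟩⟩
    infer_instance
  unfold invKernel
  rw [integrable_indicator_iff measurableSet_ball]
  refine (integrableOn_fun_norm_addHaar (volume : Measure (Space d)) (f := fun r : ℝ => r⁻¹)).2 ?_
  rw [finrank_euclideanSpace_fin]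
  refine IntegrableOn.congr_fun (f := fun y : ℝ => y ^ (d - 2)) ?_ ?_ measurableSet_Ioo
  · exact ((continuous_pow _).integrableOn_Icc (a := 0) (b := ε)).mono_set Ioo_subset_Icc_self
  · intro y hy
    have h0 : y ≠ 0 := hy.1.ne'
    obtain ⟨n, rfl⟩ := Nat.exists_eq_add_of_le hd
    have : 2 + n - 1 = n + 1 := by omega
    simp [this, pow_succ, h0]

/-! ### Integrals over pairs of points against a translation invariant kernel. -/

section Convolution

variable {d : ℕ} {k g : Space d → ℝ}

theorem integrable_kernel_fst (hk : Integrable k) (hg : Integrable g) :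
    Integrable (fun p : Space d × Space d => k (p.2 - p.1) * g p.1) (volume.prod volume) := by
  have := (hg.convolution_integrand (ContinuousLinearMap.mul ℝ ℝ) hk).swap
  refine this.congr (Eventually.of_forall fun p => ?_)
  simp [mul_comm]

theorem integral_kernel_fst (hk : Integrable k) (hg : Integrable g) :
    ∫ p : Space d × Space d, k (p.2 - p.1) * g p.1 ∂(volume.prod volume) =
      (∫ z, k z) * ∫ x, g x := by
  rw [integral_prod _ (integrable_kernel_fst hk hg), ← integral_const_mul]
  congr 1 with x
  simp only
  rw [integral_mul_const, integral_sub_right_eq_self k x]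

theorem integrable_kernel_snd (hk : Integrable k) (hkn : ∀ z, k (-z) = k z) (hg : Integrable g) :
    Integrable (fun p : Space d × Space d => k (p.2 - p.1) * g p.2) (volume.prod volume) := by
  refine (integrable_kernel_fst hk hg).swap.congr (Eventually.of_forall fun p => ?_)
  simp [← hkn (p.2 - p.1)]

theorem integral_kernel_snd (hk : Integrable k) (hkn : ∀ z, k (-z) = k z) (hg : Integrable g) :
    ∫ p : Space d × Space d, k (p.2 - p.1) * g p.2 ∂(volume.prod volume) =
      (∫ z, k z) * ∫ x, g x := by
  rw [← integral_kernel_fst hk hg, ← integral_prod_swap]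
  congr 1 with p
  simp [← hkn (p.2 - p.1)]

end Convolution

section Quadratic

variable {d : ℕ} {w : Space d → Space d} {ε : ℝ}

theorem norm_sub_sq_le (v w : Space d) : ‖v - w‖ ^ 2 ≤ 2 * ‖v‖ ^ 2 + 2 * ‖w‖ ^ 2 := by
  nlinarith [norm_sub_le v w, norm_nonneg (v - w), norm_nonneg v, norm_nonneg w,
    sq_nonneg (‖v‖ - ‖w‖)]

theorem integrable_bondQuadratic (hd : 2 ≤ d) (hwm : Measurable w)
    (hw : Integrable fun x => ‖w x‖ ^ 2) :
    Integrable (fun p : Space d × Space d => invKernel ε (p.2 - p.1) * ‖w p.2 - w p.1‖ ^ 2)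
      (volume.prod volume) := by
  have hk := integrable_invKernel hd ε
  refine (((integrable_kernel_snd hk (invKernel_neg ε) hw).const_mul 2).add
    ((integrable_kernel_fst hk hw).const_mul 2)).mono' ?_ (Eventually.of_forall fun p => ?_)
  · refine Measurable.aestronglyMeasurable (Measurable.mul ?_ (by fun_prop))
    exact ((measurable_norm.inv.indicator measurableSet_ball)).comp
      (measurable_snd.sub measurable_fst)
  · have := invKernel_nonneg ε (p.2 - p.1)
    rw [Real.norm_of_nonneg (by positivity), Pi.add_apply]
    nlinarith [norm_sub_sq_le (w p.2) (w p.1)]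

theorem integral_bondQuadratic_le (hd : 2 ≤ d) (hwm : Measurable w)
    (hw : Integrable fun x => ‖w x‖ ^ 2) :
    ∫ p : Space d × Space d, invKernel ε (p.2 - p.1) * ‖w p.2 - w p.1‖ ^ 2
      ∂(volume.prod volume) ≤ 4 * (∫ z, invKernel ε (z : Space d)) * ∫ x, ‖w x‖ ^ 2 := by
  have hk := integrable_invKernel hd ε
  have h1 := (integrable_kernel_snd hk (invKernel_neg ε) hw).const_mul 2
  have h2 := (integrable_kernel_fst hk hw).const_mul 2
  calc _ ≤ ∫ p : Space d × Space d, (2 * (invKernel ε (p.2 - p.1) * ‖w p.2‖ ^ 2) +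
        2 * (invKernel ε (p.2 - p.1) * ‖w p.1‖ ^ 2)) ∂(volume.prod volume) := by
        refine integral_mono (integrable_bondQuadratic hd hwm hw) (h1.add h2) fun p => ?_
        have := invKernel_nonneg ε (p.2 - p.1)
        simp only
        nlinarith [norm_sub_sq_le (w p.2) (w p.1)]
    _ = _ := by
        rw [integral_add h1 h2, integral_const_mul, integral_const_mul, integral_kernel_fst hk hw,
          integral_kernel_snd hk (invKernel_neg ε) hw]
        ring

end Quadratic

/-! ### Energy density: integrability and dependence on the displacement. -/

section Energy

variable {d : ℕ}

/-- The density of the peridynamic energy on pairs of points. -/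
def bondEnergy (f J : ℝ → ℝ) (ε : ℝ) (w : Space d → Space d) (p : Space d × Space d) : ℝ :=
  1 / ε * J (‖p.2 - p.1‖ / ε) * f (‖p.2 - p.1‖ * bondStrain w p.2 p.1 ^ 2)

/-- The peridynamic energy, up to the factor `V_d`. -/
def pdEnergy (f J : ℝ → ℝ) (ε : ℝ) (w : Space d → Space d) : ℝ :=
  ∫ p, bondEnergy f J ε w p ∂(volume.prod volume)

theorem bondStrain_eq (w : Space d → Space d) (y x : Space d) :
    bondStrain w y x = ‖y - x‖⁻¹ * ⟪w y - w x, ‖y - x‖⁻¹ • (y - x)⟫ := by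
  rw [bondStrain, real_inner_smul_left]

theorem abs_inner_direction_le (v z : Space d) : |⟪v, ‖z‖⁻¹ • z⟫| ≤ ‖v‖ := by
  refine (abs_real_inner_le_norm _ _).trans ?_
  refine mul_le_of_le_one_right (norm_nonneg _) ?_
  rw [norm_smul, norm_inv, norm_norm]
  exact inv_mul_le_one

theorem abs_bondStrain_le (w : Space d → Space d) (y x : Space d) :
    |bondStrain w y x| ≤ ‖y - x‖⁻¹ * ‖w y - w x‖ := by
  rw [bondStrain_eq, abs_mul, abs_of_nonneg (inv_nonneg.2 (norm_nonneg _))]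
  gcongr
  exact abs_inner_direction_le _ _

theorem norm_mul_bondStrain (w : Space d → Space d) (y x : Space d) :
    ‖y - x‖ * bondStrain w y x = ⟪w y - w x, ‖y - x‖⁻¹ • (y - x)⟫ := by
  rcases eq_or_ne y x with rfl | h
  · simp
  · rw [bondStrain_eq, mul_inv_cancel_left₀]
    exact norm_ne_zero_iff.2 (sub_ne_zero.2 h)

theorem norm_mul_abs_bondStrain_le (w : Space d → Space d) (y x : Space d) :
    ‖y - x‖ * |bondStrain w y x| ≤ ‖w y - w x‖ := by
  rw [← abs_norm (y - x), ← abs_mul, norm_mul_bondStrain]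
  exact abs_inner_direction_le _ _

theorem norm_mul_bondStrain_sq_le (w : Space d → Space d) (y x : Space d) :
    ‖y - x‖ * bondStrain w y x ^ 2 ≤ ‖y - x‖⁻¹ * ‖w y - w x‖ ^ 2 := by
  rw [← sq_abs, pow_two, ← mul_assoc]
  calc _ ≤ ‖w y - w x‖ * (‖y - x‖⁻¹ * ‖w y - w x‖) := by
        gcongr
        · exact norm_mul_abs_bondStrain_le w y x
        · exact abs_bondStrain_le w y x
    _ = _ := by ring

@[fun_prop]
theorem measurable_bondStrain {w : Space d → Space d} (hw : Measurable w) :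
    Measurable fun p : Space d × Space d => bondStrain w p.2 p.1 := by
  unfold bondStrain
  fun_prop

theorem bondStrain_sub (w v : Space d → Space d) (y x : Space d) :
    bondStrain (fun x => w x - v x) y x = bondStrain w y x - bondStrain v y x := by
  simp only [bondStrain]
  rw [← inner_sub_left, ← smul_sub]
  congr 2
  abel

variable {f J : ℝ → ℝ} {ε M : ℝ} {w : Space d → Space d}

/-- The common domination step: `J` is at most `M` and vanishes beyond the horizon, so the cut-off
kernel takes over the singularity `‖z‖⁻¹`. -/
theorem weight_mul_le (hM : ∀ r, 0 ≤ r → 0 ≤ J r ∧ J r ≤ M) (hJ0 : ∀ r, 1 ≤ r → J r = 0)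
    (hε : 0 < ε) (z : Space d) {s t : ℝ} (ht : 0 ≤ t) (hst : s ≤ ‖z‖⁻¹ * t) :
    1 / ε * J (‖z‖ / ε) * s ≤ M / ε * (invKernel ε z * t) := by
  rcases lt_or_ge ‖z‖ ε with h | h
  · rw [invKernel_eq h]
    have h1 := hM (‖z‖ / ε) (by positivity)
    have h2 : 0 ≤ 1 / ε * J (‖z‖ / ε) := mul_nonneg (by positivity) h1.1
    have h3 : 1 / ε * J (‖z‖ / ε) ≤ M / ε := by
      rw [one_div_mul_eq_div]; gcongr; exact h1.2
    exact (mul_le_mul_of_nonneg_left hst h2).trans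
      (mul_le_mul_of_nonneg_right h3 (by positivity))
  · rw [hJ0 _ ((one_le_div hε).2 h)]
    have := invKernel_nonneg ε z
    have h1 := (hM 0 le_rfl).1.trans (hM 0 le_rfl).2
    simp only [mul_zero, zero_mul]
    positivity

theorem weight_nonneg (hM : ∀ r, 0 ≤ r → 0 ≤ J r ∧ J r ≤ M) (hε : 0 < ε) (z : Space d) :
    0 ≤ 1 / ε * J (‖z‖ / ε) :=
  mul_nonneg (by positivity) (hM _ (by positivity)).1

theorem bondEnergy_nonneg (hf : IsCohesivePotential f)
    (hM : ∀ r, 0 ≤ r → 0 ≤ J r ∧ J r ≤ M) (hε : 0 < ε) (w : Space d → Space d)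
    (p : Space d × Space d) : 0 ≤ bondEnergy f J ε w p :=
  mul_nonneg (weight_nonneg hM hε _) (hf.nonneg (by positivity))

theorem measurable_bondEnergy (hf : IsCohesivePotential f) (hJ : Measurable J)
    (hw : Measurable w) : Measurable (bondEnergy f J ε w) := by
  unfold bondEnergy
  refine Measurable.mul (by fun_prop) (hf.measurable_comp (by fun_prop) fun p => by positivity)

theorem integrable_bondEnergy (hd : 2 ≤ d) (hf : IsCohesivePotential f)
    (hJ : Measurable J) (hM : ∀ r, 0 ≤ r → 0 ≤ J r ∧ J r ≤ M) (hJ0 : ∀ r, 1 ≤ r → J r = 0)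
    (hε : 0 < ε) (hwm : Measurable w) (hw : Integrable fun x => ‖w x‖ ^ 2) :
    Integrable (bondEnergy f J ε w) (volume.prod volume) := by
  refine ((integrable_bondQuadratic (ε := ε) hd hwm hw).const_mul
    (M / ε * potentialSlope f 0)).mono' (measurable_bondEnergy hf hJ hwm).aestronglyMeasurable
    (Eventually.of_forall fun p => ?_)
  rw [Real.norm_of_nonneg (bondEnergy_nonneg hf hM hε w p)]
  have h0 := hf.slope_zero_pos.le
  refine (weight_mul_le hM hJ0 hε (p.2 - p.1) (t := potentialSlope f 0 * ‖w p.2 - w p.1‖ ^ 2)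
    (by positivity) ?_).trans_eq (by ring)
  refine (hf.le_slope_mul (by positivity)).trans ?_
  rw [mul_left_comm ‖p.2 - p.1‖⁻¹]
  exact mul_le_mul_of_nonneg_left (norm_mul_bondStrain_sq_le _ _ _) h0

/-- `f` is Lipschitz, and the difference of squared strains is the product of the strains of `w - v`
and `w + v`. Young's inequality with a free parameter `η` separates the two factors; `η` is chosen
when continuity is proved. -/
theorem abs_pdEnergy_sub_le (hd : 2 ≤ d) (hf : IsCohesivePotential f)
    (hJ : Measurable J) (hM : ∀ r, 0 ≤ r → 0 ≤ J r ∧ J r ≤ M) (hJ0 : ∀ r, 1 ≤ r → J r = 0)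
    (hε : 0 < ε) {v : Space d → Space d} (hwm : Measurable w)
    (hw : Integrable fun x => ‖w x‖ ^ 2) (hvm : Measurable v)
    (hv : Integrable fun x => ‖v x‖ ^ 2) {η : ℝ} (hη : 0 < η) :
    |pdEnergy f J ε w - pdEnergy f J ε v| ≤
      M / ε * potentialSlope f 0 * (4 * ∫ z, invKernel ε (z : Space d)) *
        (η * (∫ x, ‖w x + v x‖ ^ 2) + η⁻¹ * ∫ x, ‖w x - v x‖ ^ 2) := by
  have hM0 : 0 ≤ M := (hM 0 le_rfl).1.trans (hM 0 le_rfl).2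
  have h0 := hf.slope_zero_pos.le
  have hsq : ∀ {a : Space d → Space d}, Measurable a → (∀ x, ‖a x‖ ^ 2 ≤
      2 * ‖w x‖ ^ 2 + 2 * ‖v x‖ ^ 2) → Integrable fun x => ‖a x‖ ^ 2 := by
    intro a ham ha
    refine ((hw.const_mul 2).add (hv.const_mul 2)).mono'
      (by fun_prop : Measurable fun x => ‖a x‖ ^ 2).aestronglyMeasurable
      (Eventually.of_forall fun x => ?_)
    rw [Real.norm_of_nonneg (by positivity)]
    exact ha x
  have hd1 : Integrable fun x => ‖w x - v x‖ ^ 2 :=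
    hsq (hwm.sub hvm) fun x => norm_sub_sq_le _ _
  have hs1 : Integrable fun x => ‖w x + v x‖ ^ 2 :=
    hsq (hwm.add hvm) fun x => by simpa using norm_sub_sq_le (w x) (-v x)
  have q1 := integrable_bondQuadratic (ε := ε) hd (hwm.add hvm) hs1
  have q2 := integrable_bondQuadratic (ε := ε) hd (hwm.sub hvm) hd1
  have hi := ((q1.const_mul η).add (q2.const_mul η⁻¹)).const_mul (M / ε * potentialSlope f 0)
  rw [pdEnergy, pdEnergy, ← integral_sub (integrable_bondEnergy hd hf hJ hM hJ0 hε hwm hw)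
    (integrable_bondEnergy hd hf hJ hM hJ0 hε hvm hv)]
  rw [← Real.norm_eq_abs]
  refine (norm_integral_le_of_norm_le hi (Eventually.of_forall fun p => ?_)).trans ?_
  · rw [bondEnergy, bondEnergy, ← mul_sub, norm_mul, 
      Real.norm_of_nonneg (weight_nonneg hM hε (p.2 - p.1)), Real.norm_eq_abs]
    refine (weight_mul_le hM hJ0 hε (p.2 - p.1) (t := potentialSlope f 0 *
      (η * ‖(w + v) p.2 - (w + v) p.1‖ ^ 2 + η⁻¹ * ‖(w - v) p.2 - (w - v) p.1‖ ^ 2))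
      (by positivity) ?_).trans_eq (by simp only [Pi.add_apply]; ring)
    refine (hf.abs_sub_le (by positivity) (by positivity)).trans ?_
    rw [mul_left_comm]
    gcongr
    -- The sum `w + v` is written as `w - (-v)` so that `bondStrain_sub` serves both factors.
    have e1 : ‖p.2 - p.1‖ * bondStrain w p.2 p.1 ^ 2 - ‖p.2 - p.1‖ * bondStrain v p.2 p.1 ^ 2 =
        (‖p.2 - p.1‖ * bondStrain (fun x => w x - v x) p.2 p.1) *
          bondStrain (fun x => w x - (fun x => -v x) x) p.2 p.1 := by
      have : bondStrain (fun x => -v x) p.2 p.1 = -bondStrain v p.2 p.1 := by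
        have h : -v p.2 - -v p.1 = -(v p.2 - v p.1) := by abel
        rw [bondStrain, h, smul_neg, inner_neg_left, bondStrain]
      rw [bondStrain_sub, bondStrain_sub, this]
      ring
    rw [e1, abs_mul, abs_mul, abs_norm]
    have e2 := norm_mul_abs_bondStrain_le (fun x => w x - v x) p.2 p.1
    have e3 := abs_bondStrain_le (fun x => w x - (fun x => -v x) x) p.2 p.1
    refine (mul_le_mul e2 e3 (abs_nonneg _) (norm_nonneg _)).trans ?_
    rw [mul_left_comm]
    gcongr
    simp only [sub_neg_eq_add, Pi.add_apply, Pi.sub_apply]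
    set A := ‖w p.2 - v p.2 - (w p.1 - v p.1)‖
    set B := ‖w p.2 + v p.2 - (w p.1 + v p.1)‖
    have hAB : A * B ≤ (η * B ^ 2 + η⁻¹ * A ^ 2) := by
      have : 0 ≤ η⁻¹ * (η * B - A) ^ 2 := by positivity
      have h2 : η⁻¹ * (η * B - A) ^ 2 = η * B ^ 2 + η⁻¹ * A ^ 2 - 2 * (A * B) := by
        field_simp
        ring
      have : 0 ≤ A * B := by positivity
      linarith
    exact hAB
  · rw [integral_const_mul, integral_add' (q1.const_mul η) (q2.const_mul η⁻¹), integral_const_mul,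
      integral_const_mul, mul_assoc (M / ε * potentialSlope f 0)]
    gcongr ?_ * ?_
    have b1 := integral_bondQuadratic_le (ε := ε) hd (hwm.add hvm) hs1
    have b2 := integral_bondQuadratic_le (ε := ε) hd (hwm.sub hvm) hd1
    have := mul_le_mul_of_nonneg_left b1 hη.le
    have := mul_le_mul_of_nonneg_left b2 (inv_nonneg.2 hη.le)
    simp only [Pi.add_apply, Pi.sub_apply] at *
    linarith

end Energy

/-! ### First variation and semiconcavity of the energy. -/

section Gradient

variable {d : ℕ} {f J : ℝ → ℝ} {ε M : ℝ} {w : Space d → Space d}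

/-- The force in the bond between the two points of a pair. -/
def pairForce (f J : ℝ → ℝ) (ε : ℝ) (w : Space d → Space d) (p : Space d × Space d) : ℝ :=
  bondForce f J ε (bondStrain w p.2 p.1) ‖p.2 - p.1‖

theorem pairForce_eq (hf : IsCohesivePotential f) (p : Space d × Space d) :
    pairForce f J ε w p = 1 / ε * J (‖p.2 - p.1‖ / ε) * (2 * bondStrain w p.2 p.1 *
      potentialSlope f (‖p.2 - p.1‖ * bondStrain w p.2 p.1 ^ 2)) :=
  hf.bondForce_eq J ε _ (norm_nonneg _) fun h => by simp [bondStrain, h]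

theorem pairForce_swap (p : Space d × Space d) :
    pairForce f J ε w p.swap = pairForce f J ε w p := by
  have h : bondStrain w p.1 p.2 = bondStrain w p.2 p.1 := by
    rw [bondStrain, bondStrain, norm_sub_rev p.1 p.2, ← neg_sub (w p.2), ← neg_sub p.2, smul_neg,
      smul_neg, inner_neg_neg]
  simp only [pairForce, Prod.fst_swap, Prod.snd_swap, h, norm_sub_rev p.1 p.2]

theorem measurable_pairForce (hf : IsCohesivePotential f) (hJ : Measurable J)
    (hw : Measurable w) : Measurable (pairForce f J ε w) := by
  rw [funext (pairForce_eq (w := w) (J := J) (ε := ε) hf)]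
  exact (by fun_prop : Measurable fun p : Space d × Space d => 1 / ε * J (‖p.2 - p.1‖ / ε)).mul
    ((by fun_prop : Measurable fun p : Space d × Space d => 2 * bondStrain w p.2 p.1).mul
      (hf.measurable_slope_comp (by fun_prop) fun p => by positivity))

/-- Young's inequality with a free `t`: `t = 1` gives integrability of the force around almost every
center, `t = ‖h‖` integrability against a test field `h`. -/
theorem abs_pairForce_mul_le (hf : IsCohesivePotential f)
    (hM : ∀ r, 0 ≤ r → 0 ≤ J r ∧ J r ≤ M) (hJ0 : ∀ r, 1 ≤ r → J r = 0)
    (hε : 0 < ε) (p : Space d × Space d) {t : ℝ} (ht : 0 ≤ t) :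
    |pairForce f J ε w p| * t ≤
      M / ε * potentialSlope f 0 * (invKernel ε (p.2 - p.1) * ‖w p.2 - w p.1‖ ^ 2 +
        invKernel ε (p.2 - p.1) * t ^ 2) := by
  have h0 := hf.slope_zero_pos.le
  have hs := hf.slope_nonneg (x := ‖p.2 - p.1‖ * bondStrain w p.2 p.1 ^ 2) (by positivity)
  have hs' := hf.slope_le (x := ‖p.2 - p.1‖ * bondStrain w p.2 p.1 ^ 2) (by positivity)
  rw [pairForce_eq hf, abs_mul, abs_of_nonneg (weight_nonneg hM hε (p.2 - p.1)), abs_mul, abs_mul,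
    abs_two, abs_of_nonneg hs, mul_assoc]
  refine (weight_mul_le hM hJ0 hε (p.2 - p.1)
    (t := potentialSlope f 0 * (‖w p.2 - w p.1‖ ^ 2 + t ^ 2)) (by positivity) ?_).trans_eq (by ring)
  have h1 := abs_bondStrain_le w p.2 p.1
  calc _ ≤ 2 * (‖p.2 - p.1‖⁻¹ * ‖w p.2 - w p.1‖) * potentialSlope f 0 * t := by gcongr
    _ = ‖p.2 - p.1‖⁻¹ * (potentialSlope f 0 * (2 * ‖w p.2 - w p.1‖ * t)) := by ring
    _ ≤ _ := by
      gcongr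
      exact two_mul_le_add_sq _ _

theorem pairForce_eq_zero (hf : IsCohesivePotential f) (hJ0 : ∀ r, 1 ≤ r → J r = 0)
    (hε : 0 < ε) (p : Space d × Space d) (hp : ε ≤ ‖p.2 - p.1‖) : pairForce f J ε w p = 0 := by
  rw [pairForce_eq hf, hJ0 _ ((one_le_div hε).2 hp)]
  simp

/-- The unit vector in direction of the bond of a pair of points. -/
def bondDirection (p : Space d × Space d) : Space d := ‖p.2 - p.1‖⁻¹ • (p.2 - p.1)

theorem measurable_bondDirection : Measurable (bondDirection : Space d × Space d → Space d) := by
  unfold bondDirection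
  fun_prop

theorem norm_bondDirection_le (p : Space d × Space d) : ‖bondDirection p‖ ≤ 1 := by
  rw [bondDirection, norm_smul, norm_inv, norm_norm]
  exact inv_mul_le_one

theorem gradPD_eq (hf : IsCohesivePotential f) (hJ0 : ∀ r, 1 ≤ r → J r = 0)
    (hε : 0 < ε) (x : Space d) :
    gradPD f J ε w x = -((2 / volume.real (Metric.ball (0 : Space d) ε)) •
      ∫ y, pairForce f J ε w (x, y) • bondDirection (x, y)) := by
  have hv : volume.real (Metric.ball x ε) = volume.real (Metric.ball (0 : Space d) ε) := by
    rw [Measure.real, Measure.real, Measure.addHaar_ball_center]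
  rw [gradPD, hv]
  congr 2
  refine setIntegral_eq_integral_of_forall_compl_eq_zero fun y hy => ?_
  rw [Metric.mem_ball, not_lt, dist_eq_norm] at hy
  exact smul_eq_zero_of_left (pairForce_eq_zero (w := w) hf hJ0 hε (x, y) hy) _

theorem integrable_pairForce_smul (hd : 2 ≤ d) (hf : IsCohesivePotential f)
    (hJ : Measurable J) (hM : ∀ r, 0 ≤ r → 0 ≤ J r ∧ J r ≤ M) (hJ0 : ∀ r, 1 ≤ r → J r = 0)
    (hε : 0 < ε) (hwm : Measurable w) (hw : Integrable fun x => ‖w x‖ ^ 2) :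
    ∀ᵐ x : Space d, Integrable fun y => pairForce f J ε w (x, y) • bondDirection (x, y) := by
  have h1 := (integrable_bondQuadratic (ε := ε) hd hwm hw).prod_right_ae
  filter_upwards [h1] with x hx
  refine ((hx.add ((integrable_invKernel hd ε).comp_sub_right x)).const_mul
    (M / ε * potentialSlope f 0)).mono' ?_ (Eventually.of_forall fun y => ?_)
  · exact (((measurable_pairForce hf hJ hwm).smul measurable_bondDirection).comp
      measurable_prodMk_left).aestronglyMeasurable
  · rw [norm_smul]
    refine (mul_le_mul_of_nonneg_left (norm_bondDirection_le _) (norm_nonneg _)).trans ?_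
    refine (abs_pairForce_mul_le hf hM hJ0 hε (x, y) zero_le_one).trans_eq ?_
    simp

theorem integrable_pairForce_mul (hd : 2 ≤ d) (hf : IsCohesivePotential f)
    (hJ : Measurable J) (hM : ∀ r, 0 ≤ r → 0 ≤ J r ∧ J r ≤ M) (hJ0 : ∀ r, 1 ≤ r → J r = 0)
    (hε : 0 < ε) (hwm : Measurable w) (hw : Integrable fun x => ‖w x‖ ^ 2)
    {h : Space d → Space d} (hhm : Measurable h) (hh : Integrable fun x => ‖h x‖ ^ 2) :
    Integrable (fun p => pairForce f J ε w p * ⟪h p.1, bondDirection p⟫)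
      (volume.prod volume) := by
  refine (((integrable_bondQuadratic (ε := ε) hd hwm hw).add
    (integrable_kernel_fst (integrable_invKernel hd ε) hh)).const_mul
    (M / ε * potentialSlope f 0)).mono' ?_ (Eventually.of_forall fun p => ?_)
  · exact ((measurable_pairForce hf hJ hwm).mul ((hhm.comp measurable_fst).inner
      measurable_bondDirection)).aestronglyMeasurable
  · rw [norm_mul]
    refine le_trans ?_ (abs_pairForce_mul_le hf hM hJ0 hε p (norm_nonneg (h p.1)))
    gcongr
    · exact le_rfl
    · exact abs_inner_direction_le _ _

/-- The gradient represents the first variation of the energy. -/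
theorem integral_inner_gradPD (hd : 2 ≤ d) (hf : IsCohesivePotential f)
    (hJ : Measurable J) (hM : ∀ r, 0 ≤ r → 0 ≤ J r ∧ J r ≤ M) (hJ0 : ∀ r, 1 ≤ r → J r = 0)
    (hε : 0 < ε) (hwm : Measurable w) (hw : Integrable fun x => ‖w x‖ ^ 2)
    {h : Space d → Space d} (hhm : Measurable h) (hh : Integrable fun x => ‖h x‖ ^ 2) :
    Integrable (fun p => pairForce f J ε w p * ⟪h p.2 - h p.1, bondDirection p⟫)
      (volume.prod volume) ∧
    ∫ p, pairForce f J ε w p * ⟪h p.2 - h p.1, bondDirection p⟫ ∂(volume.prod volume) =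
      volume.real (Metric.ball (0 : Space d) ε) * ∫ x, ⟪gradPD f J ε w x, h x⟫ := by
  have i1 := integrable_pairForce_mul hd hf hJ hM hJ0 hε hwm hw hhm hh
  -- Under exchange of the endpoints the force is symmetric and the direction antisymmetric. Both
  -- endpoint terms thus have the same integral, which accounts for the factor `2` and the sign in
  -- `gradPD`.
  have e : (fun p => pairForce f J ε w p * ⟪h p.2 - h p.1, bondDirection p⟫) = fun p =>
      -(pairForce f J ε w p.swap * ⟪h p.swap.1, bondDirection p.swap⟫) -
        pairForce f J ε w p * ⟪h p.1, bondDirection p⟫ := by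
    ext p
    have hb : bondDirection p.swap = -bondDirection p := by
      simp only [bondDirection, Prod.fst_swap, Prod.snd_swap]
      rw [norm_sub_rev, ← smul_neg, neg_sub]
    rw [pairForce_swap, hb, inner_neg_right, inner_sub_left, Prod.fst_swap]
    ring
  have hV : 0 < volume.real (Metric.ball (0 : Space d) ε) := by
    rw [Measure.real]
    exact ENNReal.toReal_pos (Metric.measure_ball_pos _ _ hε).ne' measure_ball_lt_top.ne
  rw [e]
  have i2 : Integrable (fun p => -(pairForce f J ε w p.swap * ⟪h p.swap.1, bondDirection p.swap⟫))
      (volume.prod volume) := i1.swap.neg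
  refine ⟨i2.sub i1, ?_⟩
  rw [integral_sub i2 i1, integral_neg,
    integral_prod_swap (fun p => pairForce f J ε w p * ⟪h p.1, bondDirection p⟫),
    integral_prod _ i1]
  have : ∀ᵐ x : Space d, ⟪gradPD f J ε w x, h x⟫ =
      -(2 / volume.real (Metric.ball (0 : Space d) ε)) *
        ∫ y, pairForce f J ε w (x, y) * ⟪h x, bondDirection (x, y)⟫ := by
    filter_upwards [integrable_pairForce_smul hd hf hJ hM hJ0 hε hwm hw] with x hx
    rw [gradPD_eq hf hJ0 hε, inner_neg_left, real_inner_smul_left, real_inner_comm,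
      ← integral_inner hx]
    simp only [real_inner_smul_right]
    ring
  rw [integral_congr_ae this, integral_const_mul]
  field_simp
  ring

/-- Semiconcavity of the energy. -/
theorem pdEnergy_le (hd : 2 ≤ d) (hf : IsCohesivePotential f)
    (hJ : Measurable J) (hM : ∀ r, 0 ≤ r → 0 ≤ J r ∧ J r ≤ M) (hJ0 : ∀ r, 1 ≤ r → J r = 0)
    (hε : 0 < ε) (hwm : Measurable w) (hw : Integrable fun x => ‖w x‖ ^ 2)
    {v : Space d → Space d} (hvm : Measurable v) (hv : Integrable fun x => ‖v x‖ ^ 2) :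
    pdEnergy f J ε v ≤ pdEnergy f J ε w +
      volume.real (Metric.ball (0 : Space d) ε) * (∫ x, ⟪gradPD f J ε w x, v x - w x⟫) +
      M / ε * potentialSlope f 0 * (4 * ∫ z, invKernel ε (z : Space d)) *
        ∫ x, ‖v x - w x‖ ^ 2 := by
  have h0 := hf.slope_zero_pos.le
  have hM0 : 0 ≤ M := (hM 0 le_rfl).1.trans (hM 0 le_rfl).2
  have hhm : Measurable fun x => v x - w x := hvm.sub hwm
  have hh : Integrable fun x => ‖v x - w x‖ ^ 2 := by
    refine ((hv.const_mul 2).add (hw.const_mul 2)).mono'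
      (by fun_prop : Measurable fun x => ‖v x - w x‖ ^ 2).aestronglyMeasurable
      (Eventually.of_forall fun x => ?_)
    rw [Real.norm_of_nonneg (by positivity)]
    exact norm_sub_sq_le _ _
  obtain ⟨i1, e1⟩ := integral_inner_gradPD hd hf hJ hM hJ0 hε hwm hw hhm hh
  have q := integrable_bondQuadratic (ε := ε) hd hhm hh
  have iw := integrable_bondEnergy hd hf hJ hM hJ0 hε hwm hw
  rw [← e1]
  have b := mul_le_mul_of_nonneg_left (integral_bondQuadratic_le (ε := ε) hd hhm hh)
    (by positivity : 0 ≤ M / ε * potentialSlope f 0)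
  -- On each bond, the tangent inequality from `r S²` to `r (S + H)²` leaves `f'(r S²) (2 r S H + r
  -- H²)`. The first term is the force tested with `v - w`; the second is quadratic and bounded
  -- through `f' ≤ f'(0)`.
  have key : pdEnergy f J ε v ≤ ∫ p, (bondEnergy f J ε w p +
      pairForce f J ε w p * ⟪v p.2 - w p.2 - (v p.1 - w p.1), bondDirection p⟫ +
      M / ε * potentialSlope f 0 * (invKernel ε (p.2 - p.1) *
        ‖v p.2 - w p.2 - (v p.1 - w p.1)‖ ^ 2)) ∂(volume.prod volume) := by
    refine integral_mono (integrable_bondEnergy hd hf hJ hM hJ0 hε hvm hv)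
      ((iw.add i1).add (q.const_mul _)) fun p => ?_
    have hS := bondStrain_sub v w p.2 p.1
    have hH := norm_mul_bondStrain (fun x => v x - w x) p.2 p.1
    have hq := norm_mul_bondStrain_sq_le (fun x => v x - w x) p.2 p.1
    set H := bondStrain (fun x => v x - w x) p.2 p.1 with hHd
    set S := bondStrain w p.2 p.1 with hSd
    have hv' : bondStrain v p.2 p.1 = S + H := by rw [hS]; ring
    set r := ‖p.2 - p.1‖ with hr
    have hr0 : 0 ≤ r := norm_nonneg _
    have ht := hf.tangent (x := r * S ^ 2) (y := r * (S + H) ^ 2) (by positivity) (by positivity)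
    have hs := hf.slope_le (x := r * S ^ 2) (by positivity)
    have hdir : ⟪v p.2 - w p.2 - (v p.1 - w p.1), bondDirection p⟫ = r * H := by
      rw [hH, bondDirection]
    have hk := weight_mul_le hM hJ0 hε (p.2 - p.1)
      (t := potentialSlope f 0 * ‖v p.2 - w p.2 - (v p.1 - w p.1)‖ ^ 2)
      (s := potentialSlope f (r * S ^ 2) * (r * H ^ 2)) (by positivity) (by
        rw [mul_left_comm ‖p.2 - p.1‖⁻¹]
        refine mul_le_mul hs hq (by positivity) h0)
    have hw0 := weight_nonneg hM hε (p.2 - p.1)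
    rw [bondEnergy, bondEnergy, pairForce_eq hf, hdir, hv', ← hr, ← hSd]
    rw [← hr] at hw0 hk
    have := mul_le_mul_of_nonneg_left ht hw0
    linear_combination this + hk
  refine key.trans ?_
  have i2 : Integrable (fun p => bondEnergy f J ε w p +
      pairForce f J ε w p * ⟪v p.2 - w p.2 - (v p.1 - w p.1), bondDirection p⟫)
      (volume.prod volume) := iw.add i1
  rw [integral_add i2 (q.const_mul _), integral_add iw i1, integral_const_mul, pdEnergy]
  linarith

end Gradient

/-! ### Norms and inner products of `L20` in terms of pointwise fields. -/

section Fields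

variable {d : ℕ} {D : Set (Space d)} {a : ℝ}

theorem measurable_toField (w : L20 D a) : Measurable (toField w) :=
  (Lp.stronglyMeasurable (w : L2Field d)).measurable

theorem memLp_toField (w : L20 D a) : MemLp (toField w) 2 := Lp.memLp (w : L2Field d)

theorem integrable_norm_sq_toField (w : L20 D a) : Integrable fun x => ‖toField w x‖ ^ 2 :=
  (memLp_toField w).integrable_norm_pow two_ne_zero

theorem toField_eq_zero (w : L20 D a) : ∀ᵐ x, x ∉ interiorPart D a → toField w x = 0 := w.2

theorem toField_add (v w : L20 D a) :
    toField (v + w) =ᵐ[volume] fun x => toField v x + toField w x :=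
  Lp.coeFn_add (v : L2Field d) (w : L2Field d)

theorem toField_sub (v w : L20 D a) :
    toField (v - w) =ᵐ[volume] fun x => toField v x - toField w x :=
  Lp.coeFn_sub (v : L2Field d) (w : L2Field d)

theorem toField_smul (c : ℝ) (w : L20 D a) :
    toField (c • w) =ᵐ[volume] fun x => c • toField w x :=
  Lp.coeFn_smul c (w : L2Field d)

theorem inner_eq_integral (v w : L20 D a) : ⟪v, w⟫ = ∫ x, ⟪toField v x, toField w x⟫ := by
  rw [Submodule.coe_inner, L2.inner_def]
  rfl

theorem norm_sq_eq_integral (w : L20 D a) : ‖w‖ ^ 2 = ∫ x, ‖toField w x‖ ^ 2 := by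
  rw [← real_inner_self_eq_norm_sq, inner_eq_integral]
  simp only [real_inner_self_eq_norm_sq]

theorem norm_sub_sq_eq_integral (v w : L20 D a) :
    ‖v - w‖ ^ 2 = ∫ x, ‖toField v x - toField w x‖ ^ 2 := by
  rw [norm_sq_eq_integral]
  refine integral_congr_ae ?_
  filter_upwards [toField_sub v w] with x hx
  rw [hx]

theorem norm_add_sq_eq_integral (v w : L20 D a) :
    ‖v + w‖ ^ 2 = ∫ x, ‖toField v x + toField w x‖ ^ 2 := by
  rw [norm_sq_eq_integral]
  refine integral_congr_ae ?_
  filter_upwards [toField_add v w] with x hx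
  rw [hx]

end Fields

/-! ### Energy growth along a cohesive evolution. -/

section Dynamics

variable {d : ℕ} {D : Set (Space d)} {a ρ T ε : ℝ} {f J : ℝ → ℝ} {b : ℝ → L20 D a}
  {u₀ v₀ : L20 D a} {u : ℝ → L20 D a}

theorem measurableSet_interiorPart (hD : IsOpen D) : MeasurableSet (interiorPart D a) :=
  hD.measurableSet.inter (measurableSet_lt measurable_const
    (Metric.continuous_infDist_pt _).measurable)

/-- The equation of motion holds in the interior part only, which is enough because fields in `L20`
vanish elsewhere. -/
theorem integral_gradPD_of_evolution (hD : IsOpen D)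
    (hu : IsCohesiveEvolution D a ρ T f J b u₀ v₀ ε u) {t : ℝ} (ht : t ∈ Icc 0 T) (h : L20 D a) :
    ∫ x, ⟪gradPD f J ε (toField (u t)) x, toField h x⟫ =
      ⟪b t - ρ • iteratedDerivWithin 2 u (Icc 0 T) t, h⟫ := by
  rw [inner_eq_integral]
  refine integral_congr_ae ?_
  have hm := (ae_restrict_iff' (measurableSet_interiorPart hD)).1 (hu.motion t ht)
  filter_upwards [hm, toField_eq_zero h,
    toField_sub (b t) (ρ • iteratedDerivWithin 2 u (Icc 0 T) t),
    toField_smul ρ (iteratedDerivWithin 2 u (Icc 0 T) t)] with x h1 h2 h3 h4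
  by_cases hx : x ∈ interiorPart D a
  · rw [h3, h4, h1 hx]
    congr 1
    abel
  · rw [h2 hx, inner_zero_right, inner_zero_right]

theorem pdEnergy_continuousOn (hd : 2 ≤ d) (hf : IsCohesivePotential f)
    (hJ : IsInfluenceFunction d J) (hε : 0 < ε) {s : Set ℝ} (hu : ContinuousOn u s) :
    ContinuousOn (fun t => pdEnergy f J ε (toField (u t))) s := by
  obtain ⟨M, hM0, hM⟩ := hJ.exists_bound
  suffices h : Continuous fun w : L20 D a => pdEnergy f J ε (toField w) from h.comp_continuousOn hu
  rw [continuous_iff_continuousAt]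
  intro v
  set C := M / ε * potentialSlope f 0 * (4 * ∫ z, invKernel ε (z : Space d))
  have key : ∀ w : L20 D a, |pdEnergy f J ε (toField w) - pdEnergy f J ε (toField v)| ≤
      C * ((‖w + v‖ ^ 2 + 1) * ‖w - v‖) := by
    intro w
    rcases eq_or_ne w v with rfl | hwv
    · simp
    -- With `η = ‖w - v‖` both terms of the estimate carry one factor `‖w - v‖`.
    have hη : 0 < ‖w - v‖ := norm_pos_iff.2 (sub_ne_zero.2 hwv)
    refine (abs_pdEnergy_sub_le hd hf hJ.measurable hM hJ.eq_zero hε (measurable_toField w)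
      (integrable_norm_sq_toField w) (measurable_toField v) (integrable_norm_sq_toField v)
      hη).trans_eq ?_
    rw [← norm_sub_sq_eq_integral, ← norm_add_sq_eq_integral]
    congr 1
    field_simp
  rw [ContinuousAt, tendsto_iff_norm_sub_tendsto_zero]
  have hc : Continuous fun w : L20 D a => C * ((‖w + v‖ ^ 2 + 1) * ‖w - v‖) := by fun_prop
  have hl := hc.tendsto v
  simp only [sub_self, norm_zero, mul_zero] at hl
  exact squeeze_zero (fun w => norm_nonneg _) key hl

theorem pdEnergy_nonneg (hf : IsCohesivePotential f) (hJ : IsInfluenceFunction d J) (hε : 0 < ε)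
    (w : Space d → Space d) : 0 ≤ pdEnergy f J ε w := by
  obtain ⟨M, hM0, hM⟩ := hJ.exists_bound
  exact integral_nonneg fun p => bondEnergy_nonneg hf hM hε w p

/-- Bound for the energy of a cohesive evolution in terms of the data. -/
theorem pdEnergy_le_gronwallBound (hd : 2 ≤ d) (hD : IsOpen D) (hρ : 0 < ρ) (hT : 0 < T)
    (hf : IsCohesivePotential f) (hJ : IsInfluenceFunction d J) (hε : 0 < ε)
    (hu : IsCohesiveEvolution D a ρ T f J b u₀ v₀ ε u) {B E : ℝ}
    (hB : ∀ t ∈ Icc 0 T, ‖b t‖ ≤ B)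
    (hE : ρ / 2 * ‖v₀‖ ^ 2 + (volume.real (Metric.ball (0 : Space d) ε))⁻¹ *
      pdEnergy f J ε (toField u₀) ≤ E) {t : ℝ} (ht : t ∈ Icc 0 T) :
    (volume.real (Metric.ball (0 : Space d) ε))⁻¹ * pdEnergy f J ε (toField (u t)) ≤
      gronwallBound E (1 / ρ) (B ^ 2 / 2) T := by
  obtain ⟨M, hM0, hM⟩ := hJ.exists_bound
  set V := volume.real (Metric.ball (0 : Space d) ε) with hVd
  have hV : 0 < V := ENNReal.toReal_pos (Metric.measure_ball_pos _ _ hε).ne' measure_ball_lt_top.ne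
  set C := M / ε * potentialSlope f 0 * (4 * ∫ z, invKernel ε (z : Space d)) with hC
  set u' : ℝ → L20 D a := derivWithin u (Icc 0 T) with hu'
  have huniq : UniqueDiffOn ℝ (Icc 0 T) := uniqueDiffOn_Icc hT
  have hd0 : ∀ s ∈ Icc 0 T, HasDerivWithinAt u (u' s) (Icc 0 T) s := fun s hs =>
    (hu.contDiffOn.differentiableOn (by simp) s hs).hasDerivWithinAt
  have hcd : ContDiffOn ℝ 1 u' (Icc 0 T) := hu.contDiffOn.derivWithin huniq (by norm_num)
  have hd1 : ∀ s ∈ Icc 0 T,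
      HasDerivWithinAt u' (iteratedDerivWithin 2 u (Icc 0 T) s) (Icc 0 T) s := by
    intro s hs
    have := (hcd.differentiableOn (by simp) s hs).hasDerivWithinAt
    have h1 : iteratedDerivWithin 1 u (Icc 0 T) = u' := iteratedDerivWithin_one
    rwa [iteratedDerivWithin_succ, h1]
  set Φ : ℝ → ℝ := fun s => ρ / 2 * ‖u' s‖ ^ 2 + V⁻¹ * pdEnergy f J ε (toField (u s)) with hΦ
  have hΦc : ContinuousOn Φ (Icc 0 T) :=
    (continuousOn_const.mul (hcd.continuousOn.norm.pow 2)).add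
      (continuousOn_const.mul (pdEnergy_continuousOn hd hf hJ hε hu.contDiffOn.continuousOn))
  have hE0 : Φ 0 ≤ E := by
    simpa only [hΦ, hu', hu.initial_velocity, hu.initial_displacement] using hE
  have hpd : ∀ s, 0 ≤ V⁻¹ * pdEnergy f J ε (toField (u s)) := fun s =>
    mul_nonneg (inv_nonneg.2 hV.le) (pdEnergy_nonneg hf hJ hε _)
  have hB0 : 0 ≤ B := (norm_nonneg _).trans (hB t ht)
  -- Only right difference quotients of `Φ` have to be bounded above, and the rate `⟪b, u'⟫ ≤ Φ / ρ
  -- + B² / 2` does not involve the horizon.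
  have main := le_gronwallBound_of_liminf_deriv_right_le (f := Φ) (f' := fun s => ⟪b s, u' s⟫)
    (δ := E) (K := 1 / ρ) (ε := B ^ 2 / 2) hΦc ?_ hE0 ?_ t ht
  · refine le_trans (le_trans ?_ main) (gronwallBound_mono ?_ (by positivity) (by positivity) ?_)
    · have : 0 ≤ ρ / 2 * ‖u' t‖ ^ 2 := by positivity
      simp only [hΦ]
      linarith
    · refine le_trans ?_ hE0
      have : 0 ≤ ρ / 2 * ‖u' 0‖ ^ 2 := by positivity
      exact add_nonneg this (hpd 0)
    · linarith [ht.2]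
  · intro s hs r hr
    have hsI : s ∈ Icc 0 T := Ico_subset_Icc_self hs
    set p := b s - ρ • iteratedDerivWithin 2 u (Icc 0 T) s with hp
    -- A differentiable function whose increments from `s` dominate those of `Φ`: the energy is
    -- replaced by its semiconcave upper bound at `u s`. At `s` the quadratic term has derivative
    -- zero, and the acceleration in `p` cancels the derivative of the kinetic energy.
    set Ψ : ℝ → ℝ := fun z => ρ / 2 * ‖u' z‖ ^ 2 + ⟪p, u z - u s⟫ + V⁻¹ * C * ‖u z - u s‖ ^ 2
      with hΨ
    have hle : ∀ z, Φ z - Φ s ≤ Ψ z - Ψ s := by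
      intro z
      have h1 := pdEnergy_le hd hf hJ.measurable hM hJ.eq_zero hε (measurable_toField (u s))
        (integrable_norm_sq_toField _) (measurable_toField (u z)) (integrable_norm_sq_toField _)
      have h2 : ∫ x, ⟪gradPD f J ε (toField (u s)) x, toField (u z) x - toField (u s) x⟫ =
          ⟪p, u z - u s⟫ := by
        rw [hp, ← integral_gradPD_of_evolution hD hu hsI]
        refine integral_congr_ae ?_
        filter_upwards [toField_sub (u z) (u s)] with x hx
        rw [hx]
      rw [h2, ← norm_sub_sq_eq_integral, ← hC, ← hVd] at h1
      have h3 := mul_le_mul_of_nonneg_left h1 (inv_nonneg.2 hV.le)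
      rw [mul_add, mul_add, inv_mul_cancel_left₀ hV.ne'] at h3
      simp only [hΦ, hΨ, sub_self, inner_zero_right, norm_zero]
      linarith
    have hΨd : HasDerivWithinAt Ψ ⟪b s, u' s⟫ (Icc 0 T) s := by
      have e1 := ((hd1 s hsI).norm_sq).const_mul (ρ / 2)
      have e2 := ((hasDerivWithinAt_const s (Icc 0 T) p).inner ℝ ((hd0 s hsI).sub_const (u s)))
      have e3 := (((hd0 s hsI).sub_const (u s)).norm_sq).const_mul (V⁻¹ * C)
      refine ((e1.add e2).add e3).congr_deriv ?_
      simp only [sub_self, inner_zero_left, mul_zero, add_zero]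
      have hsm : ⟪ρ • iteratedDerivWithin 2 u (Icc 0 T) s, u' s⟫ =
          ρ * ⟪u' s, iteratedDerivWithin 2 u (Icc 0 T) s⟫ := by
        rw [real_inner_comm, Submodule.coe_inner, Submodule.coe_inner, Submodule.coe_smul,
          real_inner_smul_right]
      rw [hp, inner_sub_left, hsm]
      ring
    have hIoi : HasDerivWithinAt Ψ ⟪b s, u' s⟫ (Ioi s) s :=
      hΨd.mono_of_mem_nhdsWithin (mem_of_superset (Ioc_mem_nhdsGT hs.2)
        fun z hz => ⟨hs.1.trans hz.1.le, hz.2⟩)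
    have ht := hasDerivWithinAt_iff_tendsto_slope' (by simp) |>.1 hIoi
    have hev : ∀ᶠ z in 𝓝[>] s, (z - s)⁻¹ * (Φ z - Φ s) < r := by
      filter_upwards [ht.eventually (gt_mem_nhds hr), self_mem_nhdsWithin] with z hz hzs
      refine lt_of_le_of_lt ?_ hz
      rw [slope_def_module, smul_eq_mul]
      exact mul_le_mul_of_nonneg_left (hle z) (inv_nonneg.2 (sub_nonneg.2 (le_of_lt hzs)))
    exact hev.frequently
  · intro s hs
    have h1 := real_inner_le_norm (b s) (u' s)
    have h2 := hB s (Ico_subset_Icc_self hs)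
    have h3 : 1 / ρ * Φ s = ‖u' s‖ ^ 2 / 2 + 1 / ρ * (V⁻¹ * pdEnergy f J ε (toField (u s))) := by
      simp only [hΦ]
      field_simp
    have h4 : 0 ≤ 1 / ρ * (V⁻¹ * pdEnergy f J ε (toField (u s))) :=
      mul_nonneg (by positivity) (hpd s)
    have h5 : ‖b s‖ ^ 2 ≤ B ^ 2 := by gcongr
    rw [h3]
    nlinarith [sq_nonneg (‖b s‖ - ‖u' s‖)]

end Dynamics

/-! ### Volume of a single process zone. -/

section ProcessZone

variable {d : ℕ} {f J : ℝ → ℝ} {ε κ α θ : ℝ} {w : Space d → Space d}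

theorem measurableSet_highStrain (hw : Measurable w) (x : Space d) :
    MeasurableSet (highStrain ε κ α w x) := by
  refine measurableSet_ball.inter (measurableSet_lt
    (by fun_prop : Measurable fun y => κ * ‖y - x‖ ^ (α - 1)) ?_)
  exact ((measurable_bondStrain hw).comp measurable_prodMk_left).abs

theorem integrable_weight (hJ : IsInfluenceFunction d J) (hε : 0 < ε) (x : Space d) :
    IntegrableOn (fun y => ‖y - x‖ / ε * J (‖y - x‖ / ε)) (Metric.ball x ε) := by
  obtain ⟨M, hM0, hM⟩ := hJ.exists_bound
  have hJm := hJ.measurable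
  refine Measure.integrableOn_of_bounded (M := M) measure_ball_lt_top.ne
    (by fun_prop : Measurable fun y => ‖y - x‖ / ε * J (‖y - x‖ / ε)).aestronglyMeasurable ?_
  refine ae_restrict_of_forall_mem measurableSet_ball fun y hy => ?_
  rw [Metric.mem_ball, dist_eq_norm] at hy
  have h1 := hM (‖y - x‖ / ε) (by positivity)
  rw [Real.norm_of_nonneg (mul_nonneg (by positivity) h1.1)]
  exact (mul_le_of_le_one_left h1.1 ((div_le_one hε).2 hy.le)).trans h1.2

theorem integral_weight (hJ : IsInfluenceFunction d J) (hε : 0 < ε) (x : Space d) :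
    ∫ y in Metric.ball x ε, ‖y - x‖ / ε * J (‖y - x‖ / ε) = ε ^ d * influenceMass d J := by
  have h1 : influenceMass d J = ∫ ξ : Space d, ‖ξ‖ * J ‖ξ‖ := by
    refine setIntegral_eq_integral_of_forall_compl_eq_zero fun ξ hξ => ?_
    rw [mem_ball_zero_iff, not_lt] at hξ
    simp [hJ.eq_zero _ hξ]
  have h2 : ∫ y in Metric.ball x ε, ‖y - x‖ / ε * J (‖y - x‖ / ε) =
      ∫ y, ‖y - x‖ / ε * J (‖y - x‖ / ε) := by
    refine setIntegral_eq_integral_of_forall_compl_eq_zero fun y hy => ?_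
    rw [Metric.mem_ball, not_lt, dist_eq_norm] at hy
    simp [hJ.eq_zero _ ((one_le_div hε).2 hy)]
  rw [h2, integral_sub_right_eq_self (fun z => ‖z‖ / ε * J (‖z‖ / ε)) x, h1]
  have h3 := Measure.integral_comp_inv_smul_of_nonneg (volume : Measure (Space d))
    (fun ξ => ‖ξ‖ * J ‖ξ‖) hε.le
  rw [finrank_euclideanSpace_fin] at h3
  rw [← smul_eq_mul (ε ^ d), ← h3]
  congr 1 with z
  rw [norm_smul, norm_inv, Real.norm_of_nonneg hε.le, inv_mul_eq_div]

theorem weightedFraction_add (hJ : IsInfluenceFunction d J) (hε : 0 < ε) (hw : Measurable w)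
    (x : Space d) :
    weightedFraction J ε x (highStrain ε κ α w x) +
      weightedFraction J ε x (controlledStrain ε κ α w x) = 1 := by
  have hm := measurableSet_highStrain (ε := ε) (κ := κ) (α := α) hw x
  have hsub : highStrain ε κ α w x ⊆ Metric.ball x ε := fun y hy => hy.1
  have hc : controlledStrain ε κ α w x = Metric.ball x ε \ highStrain ε κ α w x := by
    ext y
    simp only [controlledStrain, highStrain, mem_ofPred_eq, Set.mem_sdiff]
    constructor
    · rintro ⟨h1, h2⟩
      exact ⟨h1, fun h => h.2.not_ge h2⟩
    · rintro ⟨h1, h2⟩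
      exact ⟨h1, not_lt.1 fun h => h2 ⟨h1, h⟩⟩
  have hpos : 0 < ε ^ d * influenceMass d J := mul_pos (by positivity) hJ.mass_pos
  rw [hc, weightedFraction, weightedFraction, ← mul_add,
    setIntegral_sdiff hm (integrable_weight hJ hε x) hsub, add_sub_cancel, integral_weight hJ hε,
    one_div_mul_cancel hpos.ne']

/-- On bonds of high strain, the energy density dominates the weight. -/
theorem weight_le_bondEnergy (hf : IsCohesivePotential f) (hJ : IsInfluenceFunction d J)
    (hε : 0 < ε) (hε1 : ε ≤ 1) (hκ : 0 < κ) (hα : 1 / 2 ≤ α) (hα1 : α < 1) {x y : Space d}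
    (hy : y ∈ highStrain ε κ α w x) :
    f (κ ^ 2) * (ε ^ (α - 1)) ^ 2 * (‖y - x‖ / ε * J (‖y - x‖ / ε)) ≤
      bondEnergy f J ε w (x, y) := by
  obtain ⟨M, hM0, hM⟩ := hJ.exists_bound
  obtain ⟨hb, hs⟩ := hy
  rw [Metric.mem_ball, dist_eq_norm] at hb
  rw [bondEnergy]
  simp only
  set r := ‖y - x‖ with hr
  set S := bondStrain w y x
  have hr0 : 0 ≤ r := norm_nonneg _
  have hw0 : 0 ≤ 1 / ε * J (r / ε) := weight_nonneg hM hε _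
  -- Put `t = r ε^(2α-2)`. Then `t ≤ ε^(2α-1) ≤ 1` by `1/2 ≤ α` and `ε ≤ 1`, so concavity gives `t
  -- f(κ²) ≤ f(t κ²)`, while the strain threshold gives `t κ² ≤ r S²`.
  have hmain : r * (ε ^ (α - 1)) ^ 2 * f (κ ^ 2) ≤ f (r * S ^ 2) := by
    rcases hr0.eq_or_lt with h | h
    · rw [← h]
      simp [hf.map_zero]
    have h1 : ε ^ (α - 1) ≤ r ^ (α - 1) :=
      Real.rpow_le_rpow_of_nonpos h hb.le (by linarith)
    have h2 : 0 < ε ^ (α - 1) := Real.rpow_pos_of_pos hε _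
    have h3 : κ * ε ^ (α - 1) ≤ |S| := (by gcongr : κ * ε ^ (α - 1) ≤ κ * r ^ (α - 1)).trans hs.le
    have h4 : ε * (ε ^ (α - 1)) ^ 2 ≤ 1 := by
      have : ε * (ε ^ (α - 1)) ^ 2 = ε ^ (2 * α - 1) := by
        rw [← Real.rpow_natCast, ← Real.rpow_mul hε.le]
        nth_rewrite 1 [← Real.rpow_one ε]
        rw [← Real.rpow_add hε]
        congr 1
        push_cast
        ring
      rw [this]
      exact Real.rpow_le_one hε.le hε1 (by linarith)
    have h5 : r * (ε ^ (α - 1)) ^ 2 ≤ 1 := le_trans (by gcongr) h4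
    refine (hf.mul_le (by positivity) h5 (by positivity)).trans
      (hf.monotoneOn (mem_Ici.2 (by positivity)) (mem_Ici.2 (by positivity)) ?_)
    have h6 : (κ * ε ^ (α - 1)) ^ 2 ≤ S ^ 2 := by
      rw [← sq_abs S]
      gcongr
    calc _ = r * (κ * ε ^ (α - 1)) ^ 2 := by ring
      _ ≤ _ := by gcongr
  calc _ = 1 / ε * J (r / ε) * (r * (ε ^ (α - 1)) ^ 2 * f (κ ^ 2)) := by ring
    _ ≤ _ := mul_le_mul_of_nonneg_left hmain hw0

/-- Volume of the process zone of a displacement of bounded energy. -/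
theorem volume_processZone_le (hd : 2 ≤ d) (D : Set (Space d)) (hf : IsCohesivePotential f)
    (hJ : IsInfluenceFunction d J) (hε : 0 < ε) (hε1 : ε ≤ 1) (hκ : 0 < κ) (hα : 1 / 2 ≤ α)
    (hα1 : α < 1) (hθ : 0 < θ) (hwm : Measurable w) (hw : Integrable fun x => ‖w x‖ ^ 2) {E : ℝ}
    (hE : (volume.real (Metric.ball (0 : Space d) ε))⁻¹ * pdEnergy f J ε w ≤ E) :
    volume (processZone D J ε κ α θ w) ≤
      ENNReal.ofReal (volume.real (Metric.ball (0 : Space d) 1) * E /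
        (f (κ ^ 2) * θ * influenceMass d J) * ε ^ (1 - (2 * α - 1))) := by
  obtain ⟨M, hM0, hM⟩ := hJ.exists_bound
  have hm := hJ.mass_pos
  have hfκ : 0 < f (κ ^ 2) := hf.pos _ (by positivity)
  have hεα : 0 < ε ^ (α - 1) := Real.rpow_pos_of_pos hε _
  have hi := integrable_bondEnergy hd hf hJ.measurable hM hJ.eq_zero hε hwm hw
  set Ψ : Space d → ℝ := fun x => ∫ y, bondEnergy f J ε w (x, y)
  -- The Markov threshold: more than the fraction `θ` of the total weight `ε^d m` sits on bonds of
  -- high strain.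
  set c : ℝ := f (κ ^ 2) * (ε ^ (α - 1)) ^ 2 * (θ * (ε ^ d * influenceMass d J)) with hc
  have hc0 : 0 < c := by positivity
  have hΨ : Integrable Ψ := hi.integral_prod_left
  have hle : ∀ᵐ x, x ∈ processZone D J ε κ α θ w → c ≤ Ψ x := by
    filter_upwards [hi.prod_right_ae] with x hx hxp
    have h1 := hxp.2
    rw [weightedFraction, one_div_mul_eq_div, lt_div_iff₀ (by positivity)] at h1
    have hms := measurableSet_highStrain (ε := ε) (κ := κ) (α := α) hwm x
    calc c ≤ f (κ ^ 2) * (ε ^ (α - 1)) ^ 2 *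
          ∫ y in highStrain ε κ α w x, ‖y - x‖ / ε * J (‖y - x‖ / ε) := by
          rw [hc]; gcongr
      _ = ∫ y in highStrain ε κ α w x,
          f (κ ^ 2) * (ε ^ (α - 1)) ^ 2 * (‖y - x‖ / ε * J (‖y - x‖ / ε)) := by
          rw [integral_const_mul]
      _ ≤ ∫ y in highStrain ε κ α w x, bondEnergy f J ε w (x, y) := by
          refine integral_mono_of_nonneg (Eventually.of_forall fun y => ?_) hx.integrableOn
            (ae_restrict_of_forall_mem hms fun y hy =>
              weight_le_bondEnergy hf hJ hε hε1 hκ hα hα1 hy)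
          have := (hM (‖y - x‖ / ε) (by positivity)).1
          simp only [Pi.zero_apply]
          positivity
      _ ≤ Ψ x := setIntegral_le_integral hx
          (Eventually.of_forall fun y => bondEnergy_nonneg hf hM hε w (x, y))
  have hmark := mul_meas_ge_le_integral_of_nonneg
    (Eventually.of_forall fun x => integral_nonneg fun y => bondEnergy_nonneg hf hM hε w (x, y))
    hΨ c
  have hPD : ∫ x, Ψ x = pdEnergy f J ε w := (integral_prod _ hi).symm
  have hV : volume.real (Metric.ball (0 : Space d) ε) =
      ε ^ d * volume.real (Metric.ball (0 : Space d) 1) := by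
    rw [Measure.real, Measure.real, Measure.addHaar_ball_of_pos _ _ hε, finrank_euclideanSpace_fin,
      ENNReal.toReal_mul, ENNReal.toReal_ofReal (by positivity)]
  have hω : 0 < volume.real (Metric.ball (0 : Space d) 1) :=
    ENNReal.toReal_pos (Metric.measure_ball_pos _ _ one_pos).ne' measure_ball_lt_top.ne
  rw [hPD] at hmark
  rw [hV, inv_mul_le_iff₀ (by positivity)] at hE
  have hfin : volume {x | c ≤ Ψ x} ≠ ⊤ := (hΨ.measure_ge_lt_top hc0).ne
  calc volume (processZone D J ε κ α θ w) ≤ volume {x | c ≤ Ψ x} := measure_mono_ae hle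
    _ = ENNReal.ofReal (volume.real {x | c ≤ Ψ x}) := (ENNReal.ofReal_toReal hfin).symm
    _ ≤ _ := by
      refine ENNReal.ofReal_le_ofReal ?_
      have h1 := (le_div_iff₀' hc0).2 (hmark.trans hE)
      refine h1.trans_eq ?_
      -- The factors `ε^d` in `c` and in the volume of the ball cancel, so this is the only power
      -- left.
      have h2 : ε ^ (1 - (2 * α - 1)) = ((ε ^ (α - 1)) ^ 2)⁻¹ := by
        rw [← Real.rpow_natCast, ← Real.rpow_mul hε.le, ← Real.rpow_neg hε.le]
        congr 1
        push_cast
        ring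
      rw [h2, hc]
      have := hm.ne'
      field_simp

end ProcessZone

/-! ### Summation over the horizons and the limit set. -/

section Union

variable {d : ℕ} {D : Set (Space d)} {J : ℝ → ℝ} {κ α θ : ℝ} {w : ℕ → Space d → Space d}

theorem horizon_pos (k : ℕ) : 0 < horizon k := by
  unfold horizon
  positivity

theorem horizon_le_one (k : ℕ) : horizon k ≤ 1 :=
  div_le_one_of_le₀ (one_le_pow₀ one_le_two) (by positivity)

theorem CPZ_mono {δ δ' : ℝ} (h : δ ≤ δ') : CPZ D J κ α θ w δ ⊆ CPZ D J κ α θ w δ' :=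
  fun _ ⟨k, h1, h2, h3⟩ => ⟨k, h1, h2.trans_le h, h3⟩

theorem CPZ_subset {δ : ℝ} : CPZ D J κ α θ w δ ⊆ D := fun _ ⟨_, _, _, h⟩ => h.1

/-- A geometric series that starts at the first index with horizon below `δ`, so its leading term is
at most `δ^γ`. -/
theorem tsum_horizon_le {γ δ : ℝ} (hγ : 0 < γ) (hδ : 0 < δ) :
    ∑' k : {k : ℕ // horizon k < δ}, ENNReal.ofReal (horizon k ^ γ) ≤
      ENNReal.ofReal (δ ^ γ / (1 - (1 / 2 : ℝ) ^ γ)) := by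
  set q : ℝ := (1 / 2 : ℝ) ^ γ with hq
  have hq0 : 0 < q := by positivity
  have hq1 : q < 1 := Real.rpow_lt_one (by norm_num) (by norm_num) hγ
  have hpow : ∀ k : ℕ, horizon k ^ γ = q ^ k := fun k => by
    rw [hq, horizon, ← one_div_pow, ← Real.rpow_natCast, ← Real.rpow_natCast, ← Real.rpow_mul
      (by norm_num), ← Real.rpow_mul (by norm_num), mul_comm]
  have hex : ∃ k : ℕ, horizon k < δ := by
    obtain ⟨k, hk⟩ := exists_pow_lt_of_lt_one hδ (by norm_num : (1 / 2 : ℝ) < 1)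
    exact ⟨k, by rwa [horizon, ← one_div_pow]⟩
  set N := Nat.find hex with hN
  have hNδ : horizon N < δ := Nat.find_spec hex
  have hsub : ∀ k : {k : ℕ // horizon k < δ}, N ≤ k := fun k => Nat.find_min' hex k.2
  have hinj : Function.Injective fun k : {k : ℕ // horizon k < δ} => (k : ℕ) - N := by
    intro k l hkl
    have h1 := hsub k
    have h2 := hsub l
    ext
    simp only at hkl
    omega
  calc _ = ∑' k : {k : ℕ // horizon k < δ}, ENNReal.ofReal (q ^ N * q ^ ((k : ℕ) - N)) := by
        congr 1 with k
        rw [hpow, ← pow_add, Nat.add_sub_cancel' (hsub k)]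
    _ ≤ ∑' j : ℕ, ENNReal.ofReal (q ^ N * q ^ j) :=
        ENNReal.tsum_comp_le_tsum_of_injective hinj (fun j => ENNReal.ofReal (q ^ N * q ^ j))
    _ = ENNReal.ofReal (∑' j : ℕ, q ^ N * q ^ j) :=
        (ENNReal.ofReal_tsum_of_nonneg (fun j => by positivity)
          ((summable_geometric_of_lt_one hq0.le hq1).mul_left _)).symm
    _ ≤ _ := by
        refine ENNReal.ofReal_le_ofReal ?_
        rw [tsum_mul_left, tsum_geometric_of_lt_one hq0.le hq1, ← hpow, ← div_eq_mul_inv]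
        have := (horizon_pos N).le
        have := sub_pos.2 hq1
        gcongr

/-- Volume of `CPZ`, from bounds for the process zones. -/
theorem volume_CPZ_le {C γ δ : ℝ} (hC : 0 ≤ C) (hγ : 0 < γ) (hδ : 0 < δ)
    (h : ∀ k, 1 ≤ k → horizon k < δ → volume (processZone D J (horizon k) κ α θ (w k)) ≤
      ENNReal.ofReal (C * horizon k ^ γ)) :
    volume (CPZ D J κ α θ w δ) ≤ ENNReal.ofReal (C / (1 - (1 / 2 : ℝ) ^ γ) * δ ^ γ) := by
  -- The index `0`, excluded from `CPZ` but admitted in the geometric sum, contributes the empty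
  -- set.
  have hsub : CPZ D J κ α θ w δ ⊆ ⋃ k : {k : ℕ // horizon k < δ},
      if 1 ≤ (k : ℕ) then processZone D J (horizon k) κ α θ (w k) else ∅ := by
    rintro x ⟨k, h1, h2, h3⟩
    refine mem_iUnion.2 ⟨⟨k, h2⟩, ?_⟩
    simpa [h1] using h3
  calc _ ≤ ∑' k : {k : ℕ // horizon k < δ}, ENNReal.ofReal C * ENNReal.ofReal (horizon k ^ γ) := by
        refine (measure_mono hsub).trans ((measure_iUnion_le _).trans
          (ENNReal.tsum_le_tsum fun k => ?_))
        split_ifs with hk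
        · rw [← ENNReal.ofReal_mul hC]
          exact h k hk k.2
        · simp
    _ ≤ ENNReal.ofReal C * ENNReal.ofReal (δ ^ γ / (1 - (1 / 2 : ℝ) ^ γ)) := by
        rw [ENNReal.tsum_mul_left]
        gcongr
        exact tsum_horizon_le hγ hδ
    _ = _ := by
        rw [← ENNReal.ofReal_mul hC]
        congr 1
        ring

/-- A bound for the volume of `CPZ` implies that the limit set is negligible. -/
theorem tendsto_volume_CPZ {K γ : ℝ} (hγ : 0 < γ)
    (h : ∀ δ, 0 < δ → volume (CPZ D J κ α θ w δ) ≤ ENNReal.ofReal (K * δ ^ γ)) :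
    Tendsto (fun δ : ℝ => volume (CPZ D J κ α θ w δ)) (𝓝[>] 0) (𝓝 0) ∧
      volume (CPZzero D J κ α θ w) = 0 := by
  have hlim : Tendsto (fun δ : ℝ => ENNReal.ofReal (K * δ ^ γ)) (𝓝[>] 0) (𝓝 0) := by
    have h1 : Tendsto (fun δ : ℝ => K * δ ^ γ) (𝓝 0) (𝓝 (K * 0 ^ γ)) :=
      ((Real.continuousAt_rpow_const 0 γ (Or.inr hγ.le)).tendsto).const_mul K
    rw [Real.zero_rpow hγ.ne', mul_zero] at h1
    simpa using (ENNReal.tendsto_ofReal h1).mono_left nhdsWithin_le_nhds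
  have hev : ∀ᶠ δ : ℝ in 𝓝[>] 0, volume (CPZ D J κ α θ w δ) ≤ ENNReal.ofReal (K * δ ^ γ) := by
    filter_upwards [self_mem_nhdsWithin] with δ hδ
    exact h δ hδ
  refine ⟨tendsto_of_tendsto_of_tendsto_of_le_of_le' tendsto_const_nhds hlim
    (Eventually.of_forall fun _ => zero_le) hev, ?_⟩
  refine le_antisymm (ge_of_tendsto hlim ?_) zero_le
  filter_upwards [self_mem_nhdsWithin] with δ hδ
  exact (measure_mono fun x (hx : x ∈ CPZzero D J κ α θ w) => hx δ hδ).trans (h δ hδ)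

/-- Outside some `CPZ` the high-strain fraction is at most `θ` for all small horizons, and the two
fractions add up to one. -/
theorem diff_controlledCenters_subset (hJ : IsInfluenceFunction d J)
    (hw : ∀ k, Measurable (w k)) :
    D \ controlledCenters D J κ α θ w ⊆ CPZzero D J κ α θ w := by
  rintro x ⟨hxD, hx⟩ δ hδ
  by_contra hc
  refine hx ⟨hxD, δ, hδ, fun k hk hkδ => ?_⟩
  have h1 : ¬ θ < weightedFraction J (horizon k) x (highStrain (horizon k) κ α (w k) x) :=
    fun h => hc ⟨k, hk, hkδ, hxD, h⟩
  have h2 := weightedFraction_add (κ := κ) (α := α) hJ (horizon_pos k) (hw k) x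
  linarith

end Union

/-! ### Finite differences when the directional derivative has a singular part. -/

section SegmentIntegral

variable {d : ℕ}

/-- Smooth approximations of the indicator function of a compact set. -/
theorem exists_contDiff_tendsto_indicator {C : Set (Space d)} (hC : IsCompact C) :
    ∃ ψ : ℕ → Space d → ℝ, (∀ n, ContDiff ℝ ∞ (ψ n)) ∧ (∀ n, HasCompactSupport (ψ n)) ∧
      (∀ n x, ‖ψ n x‖ ≤ 1) ∧
      ∀ x, Tendsto (fun n => ψ n x) atTop (𝓝 (C.indicator (fun _ => (1 : ℝ)) x)) := by
  have hδ : ∀ n : ℕ, (0 : ℝ) < 1 / (n + 1) := fun n => by positivity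
  have hex : ∀ n : ℕ, ∃ f : Space d → ℝ, ContMDiff (modelWithCornersSelf ℝ (Space d))
      (modelWithCornersSelf ℝ ℝ) ∞ f ∧ range f ⊆ Icc 0 1 ∧
      Function.support f = Metric.thickening (1 / (n + 1)) C ∧ ∀ x, x ∈ C ↔ f x = 1 := fun n =>
    exists_contMDiff_support_eq_eq_one_iff _ Metric.isOpen_thickening hC.isClosed
      (Metric.self_subset_thickening (hδ n) C)
  choose ψ h1 h2 h3 h4 using hex
  refine ⟨ψ, fun n => (h1 n).contDiff, fun n => ?_, fun n x => ?_, fun x => ?_⟩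
  · refine HasCompactSupport.intro (hC.cthickening (r := 1 / ((n : ℝ) + 1))) fun x hx => ?_
    by_contra h
    have : x ∈ Function.support (ψ n) := h
    rw [h3] at this
    exact hx (Metric.thickening_subset_cthickening _ _ this)
  · have := h2 n (mem_range_self x)
    rw [Real.norm_of_nonneg this.1]
    exact this.2
  · by_cases hx : x ∈ C
    · rw [indicator_of_mem hx]
      exact tendsto_const_nhds.congr fun n => ((h4 n x).1 hx).symm
    · rw [indicator_of_notMem hx]
      obtain ⟨δ, hδ0, hδx⟩ : ∃ δ : ℝ, 0 < δ ∧ x ∉ Metric.thickening δ C := by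
        by_contra! hcon
        refine hx ?_
        rw [← hC.isClosed.closure_eq, Metric.closure_eq_iInter_thickening]
        exact mem_iInter₂.2 hcon
      have hev : ∀ᶠ n : ℕ in atTop, (1 : ℝ) / (n + 1) < δ :=
        (tendsto_one_div_add_atTop_nhds_zero_nat).eventually (gt_mem_nhds hδ0)
      refine tendsto_const_nhds.congr' ?_
      filter_upwards [hev] with n hn
      by_contra h
      have : x ∈ Function.support (ψ n) := fun h0 => h h0.symm
      rw [h3] at this
      exact hδx (Metric.thickening_mono hn.le C this)

theorem integrable_segment {h : Space d → ℝ} (hm : Measurable h) (hh : Integrable h)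
    (z : Space d) :
    Integrable (fun p : Space d × ℝ => h (p.1 + p.2 • z))
      (volume.prod (volume.restrict (Ioc (0 : ℝ) 1))) := by
  have hmeas : Measurable fun p : Space d × ℝ => h (p.1 + p.2 • z) :=
    hm.comp (measurable_fst.add (measurable_snd.smul_const z))
  rw [integrable_prod_iff' hmeas.aestronglyMeasurable]
  refine ⟨Eventually.of_forall fun s => hh.comp_add_right (s • z), ?_⟩
  have : ∀ s : ℝ, ∫ x, ‖h (x + s • z)‖ = ∫ x, ‖h x‖ := fun s =>
    integral_add_right_eq_self (fun x => ‖h x‖) (s • z)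
  simp only [this]
  exact integrable_const _

theorem integral_sub_smul {h ψ : Space d → ℝ} (c : Space d) :
    ∫ x, h x * ψ (x - c) = ∫ x, h (x + c) * ψ x := by
  rw [← integral_add_right_eq_self _ c]
  simp only [add_sub_cancel_right]

/-- Differences of a function whose directional derivative is the sum of a function and of a
measure, tested with a smooth function. -/
theorem integral_difference_mul {v h : Space d → ℝ} (hv : Integrable v) (hm : Measurable h)
    (hh : Integrable h) {μ : Measure (Space d)} [IsFiniteMeasure μ] {γ : Space d → ℝ}
    (hγ : Integrable γ μ) {z : Space d}
    (hid : ∀ φ : Space d → ℝ, ContDiff ℝ ∞ φ → HasCompactSupport φ →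
      ∫ x, v x * fderiv ℝ φ x z = -(∫ x, h x * φ x) - ∫ y, γ y * φ y ∂μ)
    {ψ : Space d → ℝ} (hψ : ContDiff ℝ ∞ ψ) (hψc : HasCompactSupport ψ) :
    ∫ x, (v (x + z) - v x - ∫ s in Ioc (0 : ℝ) 1, h (x + s • z)) * ψ x =
      ∫ p : Space d × ℝ, γ p.1 * ψ (p.1 - p.2 • z) ∂(μ.prod (volume.restrict (Ioc (0 : ℝ) 1))) := by
  obtain ⟨B, hB⟩ := hψc.exists_bound_of_continuous hψ.continuous
  have hdc : Continuous (fderiv ℝ ψ) := hψ.continuous_fderiv (by simp)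
  obtain ⟨B', hB'⟩ := (hψc.fderiv ℝ).exists_bound_of_continuous hdc
  have hshift : ∀ s : ℝ, Continuous fun x => ψ (x - s • z) := fun s =>
    hψ.continuous.comp (continuous_id.sub continuous_const)
  -- Translating the test function along `z` replaces slicing into lines: the distributional
  -- identity gives `Q' = R`, and integration over `[0, 1]` yields the difference.
  set Q : ℝ → ℝ := fun s => ∫ x, v x * ψ (x - s • z) with hQ
  set R : ℝ → ℝ := fun s => (∫ x, h x * ψ (x - s • z)) + ∫ y, γ y * ψ (y - s • z) ∂μ with hR
  have hcont : ∀ {ν : Measure (Space d)} {k : Space d → ℝ}, Integrable k ν →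
      Continuous fun s : ℝ => ∫ x, k x * ψ (x - s • z) ∂ν := by
    intro ν k hk
    refine continuous_of_dominated (bound := fun x => ‖k x‖ * B) (fun s =>
      hk.aestronglyMeasurable.mul (hshift s).aestronglyMeasurable)
      (fun s => Eventually.of_forall fun x => ?_) (hk.norm.mul_const B)
      (Eventually.of_forall fun x => ?_)
    · rw [norm_mul]
      exact mul_le_mul_of_nonneg_left (hB _) (norm_nonneg _)
    · exact continuous_const.mul (hψ.continuous.comp (by fun_prop))
  have hRc : Continuous R := (hcont hh).add (hcont hγ)
  have hint : ∀ {ν : Measure (Space d)} {k : Space d → ℝ}, Integrable k ν → ∀ s : ℝ,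
      Integrable (fun x => k x * ψ (x - s • z)) ν := fun hk s =>
    hk.mul_bdd (c := B) (hshift s).aestronglyMeasurable (Eventually.of_forall fun x => hB _)
  have hderiv : ∀ s : ℝ, HasDerivAt Q (R s) s := by
    intro s
    have hd := hasDerivAt_integral_of_dominated_loc_of_deriv_le (μ := volume) (s := univ)
      (F := fun s x => v x * ψ (x - s • z)) (F' := fun s x => v x * -(fderiv ℝ ψ (x - s • z) z))
      (x₀ := s) (bound := fun x => ‖v x‖ * (B' * ‖z‖)) univ_mem
      (Eventually.of_forall fun s => (hint hv s).aestronglyMeasurable) (hint hv s)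
      (hv.aestronglyMeasurable.mul
        (((hdc.comp (continuous_id.sub continuous_const)).clm_apply
          continuous_const).neg.aestronglyMeasurable))
      (Eventually.of_forall fun x s _ => ?_) (hv.norm.mul_const _)
      (Eventually.of_forall fun x s _ => ?_)
    · refine hd.2.congr_deriv ?_
      have h1 := hid (fun x => ψ (x - s • z)) (hψ.comp (contDiff_id.sub contDiff_const))
        (hψc.comp_homeomorph (Homeomorph.subRight (s • z)))
      simp only [fderiv_comp_sub] at h1
      simp only [mul_neg, integral_neg, h1, hR]
      ring
    · rw [norm_mul, norm_neg]
      gcongr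
      exact (ContinuousLinearMap.le_opNorm _ _).trans
        (mul_le_mul_of_nonneg_right (hB' _) (norm_nonneg _))
    · have h1 : HasDerivAt (fun s : ℝ => x - s • z) (-z) s := by
        simpa using ((hasDerivAt_id s).smul_const z).const_sub x
      have h2 := ((hψ.differentiable (by simp)) (x - s • z)).hasFDerivAt.comp_hasDerivAt s h1
      simpa using h2.const_mul (v x)
  have hftc : ∫ s in Ioc (0 : ℝ) 1, R s = Q 1 - Q 0 := by
    rw [← intervalIntegral.integral_of_le zero_le_one]
    exact intervalIntegral.integral_eq_sub_of_hasDerivAt (fun s _ => hderiv s)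
      (hRc.intervalIntegrable 0 1)
  have hQ1 : Q 1 = ∫ x, v (x + z) * ψ x := by
    simp only [hQ, one_smul]
    exact integral_sub_smul z
  have hQ0 : Q 0 = ∫ x, v x * ψ x := by simp [hQ]
  have hprod : Integrable (fun p : Space d × ℝ => h (p.1 + p.2 • z) * ψ p.1)
      (volume.prod (volume.restrict (Ioc (0 : ℝ) 1))) :=
    (integrable_segment hm hh z).mul_bdd (c := B)
      (hψ.continuous.comp continuous_fst).aestronglyMeasurable (Eventually.of_forall fun p => hB _)
  have hRh : ∫ s in Ioc (0 : ℝ) 1, ∫ x, h x * ψ (x - s • z) =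
      ∫ x, (∫ s in Ioc (0 : ℝ) 1, h (x + s • z)) * ψ x := by
    simp only [integral_sub_smul]
    rw [← integral_integral_swap hprod]
    simp only [integral_mul_const]
  have hγp : Integrable (fun p : Space d × ℝ => γ p.1 * ψ (p.1 - p.2 • z))
      (μ.prod (volume.restrict (Ioc (0 : ℝ) 1))) :=
    (hγ.comp_fst _).mul_bdd (c := B)
      (hψ.continuous.comp (by fun_prop)).aestronglyMeasurable (Eventually.of_forall fun p => hB _)
  have hRγ : ∫ s in Ioc (0 : ℝ) 1, ∫ y, γ y * ψ (y - s • z) ∂μ =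
      ∫ p : Space d × ℝ, γ p.1 * ψ (p.1 - p.2 • z)
        ∂(μ.prod (volume.restrict (Ioc (0 : ℝ) 1))) := (integral_prod_symm _ hγp).symm
  have hii : ∀ {k : Space d → ℝ}, Integrable k → Integrable fun x => k x * ψ x := fun hk =>
    hk.mul_bdd (c := B) hψ.continuous.aestronglyMeasurable (Eventually.of_forall hB)
  have i1 := hii (hv.comp_add_right z)
  have i2 := hii hv
  have i3 : Integrable fun x => (∫ s in Ioc (0 : ℝ) 1, h (x + s • z)) * ψ x :=
    hii (integrable_segment hm hh z).integral_prod_left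
  have i4 : Integrable fun x => v (x + z) * ψ x - v x * ψ x := i1.sub i2
  have hsplit : ∫ x, (v (x + z) - v x - ∫ s in Ioc (0 : ℝ) 1, h (x + s • z)) * ψ x =
      (∫ x, v (x + z) * ψ x) - (∫ x, v x * ψ x) -
        ∫ x, (∫ s in Ioc (0 : ℝ) 1, h (x + s • z)) * ψ x := by
    rw [← integral_sub i1 i2, ← integral_sub i4 i3]
    congr 1 with x
    ring
  have hRs : ∫ s in Ioc (0 : ℝ) 1, R s = (∫ s in Ioc (0 : ℝ) 1, ∫ x, h x * ψ (x - s • z)) +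
      ∫ s in Ioc (0 : ℝ) 1, ∫ y, γ y * ψ (y - s • z) ∂μ := by
    refine integral_add ?_ ?_
    · exact ((hcont hh).integrableOn_Icc (a := 0) (b := 1)).mono_set Ioc_subset_Icc_self
    · exact ((hcont hγ).integrableOn_Icc (a := 0) (b := 1)).mono_set Ioc_subset_Icc_self
  rw [hsplit, ← hRγ, ← hRh, ← hQ1, ← hQ0, ← hftc, hRs]
  ring

/-- Away from the segments that meet the carrier of the singular part, differences are integrals
of the regular part of the directional derivative. -/
theorem ae_difference_eq_integral {v h : Space d → ℝ} (hv : Integrable v) (hm : Measurable h)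
    (hh : Integrable h) {μ : Measure (Space d)} [IsFiniteMeasure μ] {γ : Space d → ℝ}
    (hγ : Integrable γ μ) {z : Space d}
    (hid : ∀ φ : Space d → ℝ, ContDiff ℝ ∞ φ → HasCompactSupport φ →
      ∫ x, v x * fderiv ℝ φ x z = -(∫ x, h x * φ x) - ∫ y, γ y * φ y ∂μ)
    {K G : Set (Space d)} (hK : ∀ᵐ y ∂μ, y ∈ K) (hG : IsOpen G)
    (hKG : ∀ y ∈ K, ∀ s ∈ Ioc (0 : ℝ) 1, y - s • z ∈ G) :
    ∀ᵐ x, x ∉ G → v (x + z) - v x = ∫ s in Ioc (0 : ℝ) 1, h (x + s • z) := by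
  set q : Space d → ℝ := fun x => v (x + z) - v x - ∫ s in Ioc (0 : ℝ) 1, h (x + s • z) with hq
  have hqi : Integrable q :=
    ((hv.comp_add_right z).sub hv).sub (integrable_segment hm hh z).integral_prod_left
  -- Testing with smooth approximations of the indicator of `C` removes the singular term in the
  -- limit, because the points `y - s z` with `y ∈ K` lie in `G` and so miss `C`.
  have hcomp : ∀ C : Set (Space d), IsCompact C → C ⊆ Gᶜ → ∫ x in C, q x = 0 := by
    intro C hC hCG
    obtain ⟨ψ, h1, h2, h3, h4⟩ := exists_contDiff_tendsto_indicator hC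
    have l1 : Tendsto (fun n => ∫ x, q x * ψ n x) atTop
        (𝓝 (∫ x, q x * C.indicator (fun _ => (1 : ℝ)) x)) := by
      refine tendsto_integral_of_dominated_convergence (fun x => ‖q x‖)
        (fun n => hqi.aestronglyMeasurable.mul (h1 n).continuous.aestronglyMeasurable) hqi.norm
        (fun n => Eventually.of_forall fun x => ?_)
        (Eventually.of_forall fun x => (h4 x).const_mul _)
      rw [norm_mul]
      exact mul_le_of_le_one_right (norm_nonneg _) (h3 n x)
    have l2 : Tendsto (fun n => ∫ p : Space d × ℝ, γ p.1 * ψ n (p.1 - p.2 • z)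
        ∂(μ.prod (volume.restrict (Ioc (0 : ℝ) 1)))) atTop (𝓝 (∫ _ : Space d × ℝ, (0 : ℝ)
        ∂(μ.prod (volume.restrict (Ioc (0 : ℝ) 1))))) := by
      have hγp := hγ.comp_fst (volume.restrict (Ioc (0 : ℝ) 1))
      refine tendsto_integral_of_dominated_convergence (fun p => ‖γ p.1‖)
        (fun n => hγp.aestronglyMeasurable.mul
          ((h1 n).continuous.comp (by fun_prop)).aestronglyMeasurable) hγp.norm
        (fun n => Eventually.of_forall fun p => ?_) ?_
      · rw [norm_mul]
        exact mul_le_of_le_one_right (norm_nonneg _) (h3 n _)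
      · have e1 : ∀ᵐ p ∂(μ.prod (volume.restrict (Ioc (0 : ℝ) 1))), p.1 ∈ K :=
          Measure.quasiMeasurePreserving_fst.ae hK
        have e2 : ∀ᵐ p ∂(μ.prod (volume.restrict (Ioc (0 : ℝ) 1))), p.2 ∈ Ioc (0 : ℝ) 1 :=
          Measure.quasiMeasurePreserving_snd.ae (ae_restrict_mem measurableSet_Ioc)
        filter_upwards [e1, e2] with p hp1 hp2
        have hnot : p.1 - p.2 • z ∉ C := fun hc => hCG hc (hKG _ hp1 _ hp2)
        have := (h4 (p.1 - p.2 • z)).const_mul (γ p.1)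
        rwa [indicator_of_notMem hnot, mul_zero] at this
    have l3 := l2.congr fun n => (integral_difference_mul hv hm hh hγ hid (h1 n) (h2 n)).symm
    have := tendsto_nhds_unique l1 l3
    rw [integral_zero] at this
    rw [← this, ← integral_indicator hC.measurableSet]
    congr 1 with x
    by_cases hx : x ∈ C <;> simp [hx]
  have hzero : Gᶜ.indicator q =ᵐ[volume] 0 := by
    refine ae_eq_zero_of_forall_setIntegral_isCompact_eq_zero
      (hqi.indicator hG.measurableSet.compl) fun C hC => ?_
    rw [setIntegral_indicator hG.measurableSet.compl]
    exact hcomp _ (hC.inter_right hG.isClosed_compl) inter_subset_right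
  filter_upwards [hzero] with x hx hxG
  rw [indicator_of_mem (mem_compl hxG)] at hx
  simp only [hq, Pi.zero_apply] at hx
  linarith

end SegmentIntegral

/-! ### Volume swept by a set of finite Hausdorff measure. -/

section Sweep

variable {d : ℕ}

/-- The set swept by `K` along the segment from `0` to `-z`. -/
def sweep (z : Space d) (K : Set (Space d)) : Set (Space d) :=
  {x | ∃ y ∈ K, ∃ s ∈ Ioc (0 : ℝ) 1, x = y - s • z}

/-- The constant in the bound for the volume of swept sets. -/
def sweepConst (d : ℕ) : ℝ := 3 * 2 ^ d * volume.real (Metric.ball (0 : Space d) 1)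

theorem sweepConst_nonneg : 0 ≤ sweepConst d := by
  unfold sweepConst
  positivity

/-- Cut the segment into `N = ⌈‖z‖ / t⌉` steps of length at most `t`; the balls of radius `2t` about
the `N + 1` nodes cover the swept set. As `t ≤ ‖z‖`, `N + 1 ≤ 3 ‖z‖ / t`, whence the constant and
the power `t^(d-1)`. -/
theorem volume_sweep_le_of_diam_le (hd : 2 ≤ d) {z : Space d} {B : Set (Space d)} {t : ℝ}
    (ht : 0 < t) (htz : t ≤ ‖z‖) (hB : Metric.ediam B ≤ ENNReal.ofReal t) :
    volume (sweep z B) ≤ ENNReal.ofReal (sweepConst d * ‖z‖ * t ^ ((d : ℝ) - 1)) := by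
  have : Nontrivial (Space d) := by
    have : Nonempty (Fin d) := ⟨⟨0, by omega⟩⟩
    infer_instance
  rcases B.eq_empty_or_nonempty with rfl | ⟨y₀, hy₀⟩
  · simp [sweep]
  have hr : 0 < ‖z‖ := ht.trans_le htz
  set N := ⌈‖z‖ / t⌉₊ with hN
  have hN1 : ‖z‖ / t ≤ N := Nat.le_ceil _
  have hN0 : (0 : ℝ) < N := (div_pos hr ht).trans_le hN1
  have hN2 : (N : ℝ) < ‖z‖ / t + 1 := Nat.ceil_lt_add_one (by positivity)
  have hsub : sweep z B ⊆
      ⋃ j ∈ Finset.range (N + 1), Metric.closedBall (y₀ - ((j : ℝ) / N) • z) (2 * t) := by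
    rintro x ⟨y, hy, s, hs, rfl⟩
    have hsN : 0 ≤ s * N := mul_nonneg hs.1.le hN0.le
    refine mem_iUnion₂.2 ⟨⌊s * N⌋₊, ?_, ?_⟩
    · rw [Finset.mem_range, Nat.lt_succ_iff]
      exact Nat.floor_le_of_le (mul_le_of_le_one_left hN0.le hs.2)
    · rw [Metric.mem_closedBall, dist_eq_norm]
      have h1 : ‖y - y₀‖ ≤ t := by
        have := (Metric.edist_le_ediam_of_mem hy hy₀).trans hB
        rw [edist_dist, ENNReal.ofReal_le_ofReal_iff ht.le, dist_eq_norm] at this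
        exact this
      have h2 : |s - ⌊s * N⌋₊ / N| ≤ 1 / N := by
        have e1 := Nat.floor_le hsN
        have e2 := Nat.lt_floor_add_one (s * N)
        rw [abs_of_nonneg (sub_nonneg.2 ((div_le_iff₀ hN0).2 e1)), sub_le_iff_le_add, ← add_div,
          le_div_iff₀ hN0]
        linarith
      have h3 : ‖(s - ⌊s * N⌋₊ / N) • z‖ ≤ t := by
        rw [norm_smul, Real.norm_eq_abs]
        calc _ ≤ 1 / N * ‖z‖ := by gcongr
          _ ≤ t := by
            rw [one_div_mul_eq_div, div_le_iff₀ hN0]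
            rwa [div_le_iff₀ ht, mul_comm] at hN1
      calc _ = ‖(y - y₀) - (s - ⌊s * N⌋₊ / N) • z‖ := by
            congr 1
            rw [sub_smul]
            abel
        _ ≤ _ := (norm_sub_le _ _).trans (by linarith)
  have hball : ∀ c : Space d, volume (Metric.closedBall c (2 * t)) =
      ENNReal.ofReal ((2 * t) ^ d * volume.real (Metric.ball (0 : Space d) 1)) := by
    intro c
    rw [Measure.addHaar_closedBall _ _ (by positivity), finrank_euclideanSpace_fin,
      ENNReal.ofReal_mul (by positivity), Measure.real,
      ENNReal.ofReal_toReal measure_ball_lt_top.ne]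
  calc volume (sweep z B) ≤ ∑ j ∈ Finset.range (N + 1),
        volume (Metric.closedBall (y₀ - ((j : ℝ) / N) • z) (2 * t)) :=
        (measure_mono hsub).trans (measure_biUnion_finset_le _ _)
    _ = ENNReal.ofReal ((N + 1) * ((2 * t) ^ d * volume.real (Metric.ball (0 : Space d) 1))) := by
        simp only [hball, Finset.sum_const, Finset.card_range, nsmul_eq_mul]
        rw [ENNReal.ofReal_mul (p := (N : ℝ) + 1) (by positivity), ← Nat.cast_succ,
          ENNReal.ofReal_natCast]
    _ ≤ _ := by
        refine ENNReal.ofReal_le_ofReal ?_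
        have h1 : (N : ℝ) + 1 ≤ 3 * (‖z‖ / t) := by
          have : 1 ≤ ‖z‖ / t := (one_le_div ht).2 htz
          linarith
        calc _ ≤ 3 * (‖z‖ / t) * ((2 * t) ^ d * volume.real (Metric.ball (0 : Space d) 1)) := by
              gcongr
          _ = _ := by
              rw [Real.rpow_sub_one ht.ne', Real.rpow_natCast, sweepConst, mul_pow]
              ring

/-- Letting `t` decrease to the diameter includes sets of diameter zero. -/
theorem volume_sweep_le_of_ediam (hd : 2 ≤ d) {z : Space d} (hz : z ≠ 0) {B : Set (Space d)}
    (hB : Metric.ediam B ≤ ENNReal.ofReal (‖z‖ / 2)) :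
    volume (sweep z B) ≤
      ENNReal.ofReal (sweepConst d * ‖z‖) * Metric.ediam B ^ ((d : ℝ) - 1) := by
  have hr : 0 < ‖z‖ := norm_pos_iff.2 hz
  have hd' : (0 : ℝ) ≤ (d : ℝ) - 1 := by
    have : (2 : ℝ) ≤ d := by exact_mod_cast hd
    linarith
  have htop : Metric.ediam B ≠ ⊤ := (hB.trans_lt ENNReal.ofReal_lt_top).ne
  set δ := (Metric.ediam B).toReal with hδ
  have hBδ : Metric.ediam B = ENNReal.ofReal δ := (ENNReal.ofReal_toReal htop).symm
  have hδ0 : 0 ≤ δ := ENNReal.toReal_nonneg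
  have hδr : δ < ‖z‖ := by
    rw [hBδ, ENNReal.ofReal_le_ofReal_iff (by positivity)] at hB
    linarith
  rw [hBδ, ENNReal.ofReal_rpow_of_nonneg hδ0 hd',
    ← ENNReal.ofReal_mul (mul_nonneg sweepConst_nonneg hr.le)]
  have hlim : Tendsto (fun t : ℝ => ENNReal.ofReal (sweepConst d * ‖z‖ * t ^ ((d : ℝ) - 1)))
      (𝓝[>] δ) (𝓝 (ENNReal.ofReal (sweepConst d * ‖z‖ * δ ^ ((d : ℝ) - 1)))) :=
    (ENNReal.tendsto_ofReal (((Real.continuousAt_rpow_const δ _ (Or.inr hd')).tendsto).const_mul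
      _)).mono_left nhdsWithin_le_nhds
  refine ge_of_tendsto hlim ?_
  filter_upwards [Ioo_mem_nhdsGT hδr] with t ht
  exact volume_sweep_le_of_diam_le hd (hδ0.trans_lt ht.1) ht.2.le
    (hBδ.trans_le (ENNReal.ofReal_le_ofReal ht.1.le))

theorem volume_sweep_le (hd : 2 ≤ d) {z : Space d} (hz : z ≠ 0) {K : Set (Space d)}
    (hK : Measure.hausdorffMeasure ((d : ℝ) - 1) K < ⊤) :
    volume (sweep z K) ≤ ENNReal.ofReal (sweepConst d * ‖z‖) *
      (Measure.hausdorffMeasure ((d : ℝ) - 1) K + 1) := by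
  have hr : 0 < ENNReal.ofReal (‖z‖ / 2) := ENNReal.ofReal_pos.2 (half_pos (norm_pos_iff.2 hz))
  -- The added `1` gives the strict inequality from which a countable cover by sets of diameter at
  -- most `‖z‖ / 2` is extracted.
  have hlt : Measure.hausdorffMeasure ((d : ℝ) - 1) K <
      Measure.hausdorffMeasure ((d : ℝ) - 1) K + 1 :=
    ENNReal.lt_add_right hK.ne one_ne_zero
  have h1 := (le_iSup₂ (f := fun (r : ℝ≥0∞) (_ : 0 < r) =>
        ⨅ (t : ℕ → Set (Space d)) (_ : K ⊆ ⋃ n, t n) (_ : ∀ n, Metric.ediam (t n) ≤ r),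
          ∑' n, ⨆ _ : (t n).Nonempty, Metric.ediam (t n) ^ ((d : ℝ) - 1)) _ hr).trans_lt
    ((Measure.hausdorffMeasure_apply ((d : ℝ) - 1) K).symm.trans_lt hlt)
  simp only [iInf_lt_iff] at h1
  obtain ⟨t, hcov, hdiam, hsum⟩ := h1
  have hsub : sweep z K ⊆ ⋃ n, sweep z (t n) := by
    rintro x ⟨y, hy, s, hs, rfl⟩
    obtain ⟨n, hn⟩ := mem_iUnion.1 (hcov hy)
    exact mem_iUnion.2 ⟨n, y, hn, s, hs, rfl⟩
  calc volume (sweep z K) ≤ ∑' n, volume (sweep z (t n)) :=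
        (measure_mono hsub).trans (measure_iUnion_le _)
    _ ≤ ∑' n, ENNReal.ofReal (sweepConst d * ‖z‖) *
        ⨆ _ : (t n).Nonempty, Metric.ediam (t n) ^ ((d : ℝ) - 1) := by
        refine ENNReal.tsum_le_tsum fun n => ?_
        rcases (t n).eq_empty_or_nonempty with h | h
        · simp [h, sweep]
        · simpa only [h, iSup_pos] using volume_sweep_le_of_ediam hd hz (hdiam n)
    _ ≤ _ := by
        rw [ENNReal.tsum_mul_left]
        gcongr

end Sweep

/-! ### The strain of the initial displacement along a fixed direction. -/

section Strain

variable {d : ℕ} {D : Set (Space d)} {a : ℝ}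

/-- A smooth function supported in `D` that is one near the interior part. -/
theorem exists_cutoff (ha : 0 < a) : ∃ χ : Space d → ℝ, ContDiff ℝ ∞ χ ∧ tsupport χ ⊆ D ∧
    (∀ x, ‖χ x‖ ≤ 1) ∧ ∀ x ∈ interiorPart D a, χ =ᶠ[𝓝 x] 1 := by
  have hc : Continuous fun x : Space d => Metric.infDist x Dᶜ := Metric.continuous_infDist_pt _
  set s : Set (Space d) := {x | a ≤ Metric.infDist x Dᶜ} with hs
  set t : Set (Space d) := {x | a / 2 < Metric.infDist x Dᶜ} with ht
  have hsc : IsClosed s := isClosed_le continuous_const hc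
  have hto : IsOpen t := isOpen_lt continuous_const hc
  have hst : s ⊆ t := fun x (hx : a ≤ Metric.infDist x Dᶜ) =>
    show a / 2 < Metric.infDist x Dᶜ by linarith
  obtain ⟨χ, h1, h2, h3, h4⟩ := exists_contMDiff_support_eq_eq_one_iff
    (modelWithCornersSelf ℝ (Space d)) (n := ⊤) hto hsc hst
  refine ⟨χ, h1.contDiff, ?_, fun x => ?_, fun x hx => ?_⟩
  · intro x hx
    have hx' : a / 2 ≤ Metric.infDist x Dᶜ := by
      rw [tsupport, h3] at hx
      have hcl : IsClosed {x : Space d | a / 2 ≤ Metric.infDist x Dᶜ} :=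
        isClosed_le continuous_const hc
      exact closure_minimal (fun y (hy : a / 2 < Metric.infDist y Dᶜ) => hy.le) hcl hx
    by_contra hxD
    rw [Metric.infDist_zero_of_mem hxD] at hx'
    linarith
  · have := h2 (mem_range_self x)
    rw [Real.norm_of_nonneg this.1]
    exact this.2
  · filter_upwards [(isOpen_lt continuous_const hc).mem_nhds hx.2] with y hy
    exact (h4 y).1 (le_of_lt hy)

/-- The distributional strain of a displacement of finite energy, tested with smooth functions
that need not be supported in the body. -/
theorem HasFiniteLEFMEnergy.exists_strain (hDopen : IsOpen D) (hDbdd : Bornology.IsBounded D)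
    (ha : 0 < a) {w : L20 D a} (hw : HasFiniteLEFMEnergy D (toField w)) :
    ∃ (e g : Space d → Matrix (Fin d) (Fin d) ℝ) (K : Set (Space d)),
      (∀ i j, Measurable fun x => e x i j) ∧ (∀ i j, MemLp (fun x => e x i j) 2) ∧
      (∀ i j, Integrable fun x => e x i j) ∧ MeasurableSet K ∧
      Measure.hausdorffMeasure ((d : ℝ) - 1) K < ⊤ ∧
      (∀ i j, IntegrableOn (fun x => g x i j) K (Measure.hausdorffMeasure ((d : ℝ) - 1))) ∧
      ∀ φ : Space d → ℝ, ContDiff ℝ ∞ φ → HasCompactSupport φ → ∀ i j : Fin d,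
        ∫ x, (toField w x i * partialDeriv φ j x + toField w x j * partialDeriv φ i x) / 2 =
          -(∫ x, e x i j * φ x) -
            ∫ x in K, g x i j * φ x ∂(Measure.hausdorffMeasure ((d : ℝ) - 1)) := by
  obtain ⟨e, g, K, he, hKm, -, hKH, hg, hid⟩ := hw
  obtain ⟨χ, hχ, hχs, hχ1, hχe⟩ := exists_cutoff (D := D) ha
  have : IsFiniteMeasure (volume.restrict D) := ⟨by simpa using hDbdd.measure_lt_top⟩
  have hmem : ∀ i j, MemLp (fun x => χ x * (he i j).aestronglyMeasurable.mk _ x) 2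
      (volume.restrict D) := fun i j => by
    refine ((memLp_congr_ae (he i j).aestronglyMeasurable.ae_eq_mk).1 (he i j)).of_le
      (hχ.continuous.aestronglyMeasurable.mul
        (he i j).aestronglyMeasurable.stronglyMeasurable_mk.aestronglyMeasurable)
      (Eventually.of_forall fun x => ?_)
    rw [norm_mul]
    exact mul_le_of_le_one_left (norm_nonneg _) (hχ1 x)
  -- Both parts of the strain are multiplied by `χ`. No derivative of `χ` appears, since `χ = 1`
  -- near the interior part and `w` vanishes almost everywhere off it.
  refine ⟨fun x i j => D.indicator (fun x => χ x * (he i j).aestronglyMeasurable.mk _ x) x,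
    fun x i j => χ x * g x i j, K, fun i j => ?_, fun i j => ?_, fun i j => ?_, hKm, hKH,
    fun i j => ?_, fun φ hφ hφc i j => ?_⟩
  · exact (hχ.continuous.measurable.mul
      (he i j).aestronglyMeasurable.stronglyMeasurable_mk.measurable).indicator hDopen.measurableSet
  · exact (memLp_indicator_iff_restrict hDopen.measurableSet).2 (hmem i j)
  · exact (integrable_indicator_iff hDopen.measurableSet).2 ((hmem i j).integrable (by norm_num))
  · exact (hg i j).bdd_mul hχ.continuous.aestronglyMeasurable (Eventually.of_forall hχ1)
  · have hts : tsupport (fun x => χ x * φ x) ⊆ D := (tsupport_mul_subset_left).trans hχs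
    have h1 := hid (fun x => χ x * φ x) (hχ.mul hφ) hφc.mul_left hts i j
    have hpd : ∀ x ∈ interiorPart D a, ∀ k,
        partialDeriv (fun x => χ x * φ x) k x = partialDeriv φ k x := by
      intro x hx k
      have : (fun x => χ x * φ x) =ᶠ[𝓝 x] φ := by
        filter_upwards [hχe x hx] with y hy
        simp [hy]
      rw [partialDeriv, this.fderiv_eq, partialDeriv]
    have h2 : ∫ x in D, (toField w x i * partialDeriv (fun x => χ x * φ x) j x +
        toField w x j * partialDeriv (fun x => χ x * φ x) i x) / 2 =
        ∫ x, (toField w x i * partialDeriv φ j x + toField w x j * partialDeriv φ i x) / 2 := by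
      rw [← integral_indicator hDopen.measurableSet]
      refine integral_congr_ae ?_
      filter_upwards [toField_eq_zero w] with x hx
      by_cases hxi : x ∈ interiorPart D a
      · rw [indicator_of_mem hxi.1, hpd x hxi, hpd x hxi]
      · have h0 := hx hxi
        by_cases hxD : x ∈ D <;> simp [hxD, h0]
    have h3 : ∫ x, D.indicator (fun x => χ x * (he i j).aestronglyMeasurable.mk _ x) x * φ x =
        ∫ x in D, e x i j * (χ x * φ x) := by
      rw [← integral_indicator hDopen.measurableSet]
      refine integral_congr_ae ?_
      filter_upwards [(ae_restrict_iff' hDopen.measurableSet).1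
        (he i j).aestronglyMeasurable.ae_eq_mk] with x hx
      by_cases hxD : x ∈ D
      · rw [indicator_of_mem hxD, indicator_of_mem hxD, ← hx hxD]
        ring
      · simp [hxD]
    rw [h3, ← h2, h1]
    congr 1
    refine integral_congr_ae (Eventually.of_forall fun x => ?_)
    simp only
    ring

theorem integrable_toField (hDopen : IsOpen D) (hDbdd : Bornology.IsBounded D) (w : L20 D a) :
    Integrable (toField w) := by
  have : IsFiniteMeasure (volume.restrict D) := ⟨by simpa using hDbdd.measure_lt_top⟩
  have h1 : IntegrableOn (toField w) D :=
    ((memLp_toField w).restrict D).integrable (by norm_num)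
  refine ((integrable_indicator_iff hDopen.measurableSet).2 h1).congr ?_
  filter_upwards [toField_eq_zero w] with x hx
  by_cases hxD : x ∈ D
  · rw [indicator_of_mem hxD]
  · rw [indicator_of_notMem hxD, hx fun h => hxD h.1]

theorem fderiv_eq_sum_partialDeriv (φ : Space d → ℝ) (x z : Space d) :
    fderiv ℝ φ x z = ∑ j, z j * partialDeriv φ j x := by
  have hz : z = ∑ j, z j • EuclideanSpace.single j (1 : ℝ) := by
    ext i
    simp [Finset.sum_apply, Pi.single_apply]
  conv_lhs => rw [hz]
  simp only [map_sum, map_smul, smul_eq_mul, partialDeriv]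

/-- The integrated identity for the directional derivative along `z`. -/
theorem integral_inner_mul_fderiv {w : Space d → Space d} (hw : Integrable w)
    {e g : Space d → Matrix (Fin d) (Fin d) ℝ} {μ : Measure (Space d)}
    (he : ∀ i j, Integrable fun x => e x i j) (hg : ∀ i j, Integrable (fun x => g x i j) μ)
    (hid : ∀ φ : Space d → ℝ, ContDiff ℝ ∞ φ → HasCompactSupport φ → ∀ i j : Fin d,
      ∫ x, (w x i * partialDeriv φ j x + w x j * partialDeriv φ i x) / 2 =
        -(∫ x, e x i j * φ x) - ∫ x, g x i j * φ x ∂μ) (z : Space d)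
    {φ : Space d → ℝ} (hφ : ContDiff ℝ ∞ φ) (hφc : HasCompactSupport φ) :
    ∫ x, ⟪w x, z⟫ * fderiv ℝ φ x z =
      -(∫ x, (∑ p : Fin d × Fin d, z p.1 * z p.2 * e x p.1 p.2) * φ x) -
        ∫ y, (∑ p : Fin d × Fin d, z p.1 * z p.2 * g y p.1 p.2) * φ y ∂μ := by
  obtain ⟨B, hB⟩ := hφc.exists_bound_of_continuous hφ.continuous
  obtain ⟨B', hB'⟩ := (hφc.fderiv ℝ).exists_bound_of_continuous (hφ.continuous_fderiv (by simp))
  have hpc : ∀ j, Continuous (partialDeriv φ j) := fun j =>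
    (hφ.continuous_fderiv (by simp)).clm_apply continuous_const
  have hpb : ∀ j x, ‖partialDeriv φ j x‖ ≤ B' := fun j x => by
    refine ((fderiv ℝ φ x).le_opNorm _).trans ?_
    simpa using hB' x
  have hwi : ∀ i j, Integrable fun x => w x i * partialDeriv φ j x := fun i j =>
    (hw.eval_piLp i).mul_bdd (c := B') (hpc j).aestronglyMeasurable (Eventually.of_forall (hpb j))
  have hei : ∀ {ν : Measure (Space d)} {k : Space d → Matrix (Fin d) (Fin d) ℝ},
      (∀ i j, Integrable (fun x => k x i j) ν) →
      ∫ x, (∑ p : Fin d × Fin d, z p.1 * z p.2 * k x p.1 p.2) * φ x ∂ν =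
        ∑ p : Fin d × Fin d, z p.1 * z p.2 * ∫ x, k x p.1 p.2 * φ x ∂ν := by
    intro ν k hk
    have hki : ∀ p : Fin d × Fin d, Integrable (fun x => k x p.1 p.2 * φ x) ν := fun p =>
      (hk p.1 p.2).mul_bdd (c := B) hφ.continuous.aestronglyMeasurable (Eventually.of_forall hB)
    simp only [← integral_const_mul]
    rw [← integral_finsetSum _ fun p _ => (hki p).const_mul _]
    congr 1 with x
    rw [Finset.sum_mul]
    exact Finset.sum_congr rfl fun p _ => by ring
  -- The weights `z_i z_j` are symmetric, so the symmetrized derivatives already determine the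
  -- derivative of `⟪w, z⟫` along `z`.
  have hpt : ∀ x, ⟪w x, z⟫ * fderiv ℝ φ x z = ∑ p : Fin d × Fin d, z p.1 * z p.2 *
      ((w x p.1 * partialDeriv φ p.2 x + w x p.2 * partialDeriv φ p.1 x) / 2) := by
    intro x
    have e1 : ⟪w x, z⟫ = ∑ i, z i * w x i := by
      rw [PiLp.inner_apply]
      exact Finset.sum_congr rfl fun i _ => by simp
    have e2 : ∑ p : Fin d × Fin d, z p.1 * w x p.1 * (z p.2 * partialDeriv φ p.2 x) =
        ⟪w x, z⟫ * fderiv ℝ φ x z := by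
      rw [Fintype.sum_prod_type, e1, fderiv_eq_sum_partialDeriv, Finset.sum_mul_sum]
    have e3 : ∑ p : Fin d × Fin d, z p.2 * w x p.2 * (z p.1 * partialDeriv φ p.1 x) =
        ⟪w x, z⟫ * fderiv ℝ φ x z := by
      rw [← e2, ← (Equiv.prodComm (Fin d) (Fin d)).sum_comp]
      rfl
    have e4 : ⟪w x, z⟫ * fderiv ℝ φ x z =
        ((⟪w x, z⟫ * fderiv ℝ φ x z) + (⟪w x, z⟫ * fderiv ℝ φ x z)) / 2 := by ring
    rw [e4]
    nth_rewrite 1 [← e2]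
    rw [← e3, ← Finset.sum_add_distrib, Finset.sum_div]
    exact Finset.sum_congr rfl fun p _ => by ring
  simp only [hpt]
  rw [integral_finsetSum _ fun p _ => (((hwi p.1 p.2).add (hwi p.2 p.1)).div_const 2).const_mul _,
    hei he, hei hg, ← Finset.sum_neg_distrib, ← Finset.sum_sub_distrib]
  refine Finset.sum_congr rfl fun p _ => ?_
  rw [integral_const_mul, hid φ hφ hφc]
  ring

theorem sq_sum_mul_le (z : Space d) (A : Matrix (Fin d) (Fin d) ℝ) :
    (∑ p : Fin d × Fin d, z p.1 * z p.2 * A p.1 p.2) ^ 2 ≤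
      ‖z‖ ^ 4 * ∑ p : Fin d × Fin d, A p.1 p.2 ^ 2 := by
  refine (Finset.sum_mul_sq_le_sq_mul_sq _ _ _).trans_eq ?_
  congr 1
  have : ‖z‖ ^ 2 = ∑ i, z i ^ 2 := by
    rw [EuclideanSpace.norm_sq_eq]
    simp
  rw [show ‖z‖ ^ 4 = ‖z‖ ^ 2 * ‖z‖ ^ 2 by ring, this, Finset.sum_mul_sum, Fintype.sum_prod_type]
  simp only [mul_pow]

end Strain

/-- Jensen's inequality from nonnegativity of the variance. In extended nonnegative reals it applies
on every segment, integrable or not. -/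
theorem ofReal_sq_integral_le {Ω : Type*} [MeasurableSpace Ω] {ν : Measure Ω}
    [IsProbabilityMeasure ν] {h : Ω → ℝ} (hm : Measurable h) :
    ENNReal.ofReal ((∫ s, h s ∂ν) ^ 2) ≤ ∫⁻ s, ENNReal.ofReal (h s ^ 2) ∂ν := by
  by_cases htop : ∫⁻ s, ENNReal.ofReal (h s ^ 2) ∂ν = ⊤
  · rw [htop]
    exact le_top
  have hi2 : Integrable (fun s => h s ^ 2) ν :=
    ⟨(hm.pow_const 2).aestronglyMeasurable, by
      rw [hasFiniteIntegral_iff_ofReal (Eventually.of_forall fun s => sq_nonneg _)]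
      exact lt_top_iff_ne_top.2 htop⟩
  have hi : Integrable h ν :=
    ((memLp_two_iff_integrable_sq hm.aestronglyMeasurable).2 hi2).integrable (by norm_num)
  rw [← ofReal_integral_eq_lintegral_ofReal hi2 (Eventually.of_forall fun s => sq_nonneg _)]
  refine ENNReal.ofReal_le_ofReal ?_
  set m := ∫ s, h s ∂ν with hmdef
  have h0 : 0 ≤ ∫ s, (h s ^ 2 - 2 * m * h s + m ^ 2) ∂ν :=
    integral_nonneg fun s => by
      have : h s ^ 2 - 2 * m * h s + m ^ 2 = (h s - m) ^ 2 := by ring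
      rw [this]
      positivity
  have hi3 : Integrable (fun s => h s ^ 2 - 2 * m * h s) ν := hi2.sub (hi.const_mul _)
  rw [integral_add hi3 (integrable_const _), integral_sub hi2 (hi.const_mul _),
    integral_const_mul, ← hmdef, integral_const] at h0
  simp only [probReal_univ, one_smul] at h0
  nlinarith

/-! ### Uniform bound for the initial energy. -/

section InitialEnergy

variable {d : ℕ} {D : Set (Space d)} {a : ℝ} {f J : ℝ → ℝ}

theorem lintegral_prod_segment {k : Space d → ℝ≥0∞} (hk : Measurable k) (z : Space d) :
    ∫⁻ x, ∫⁻ s in Ioc (0 : ℝ) 1, k (x + s • z) = ∫⁻ x, k x := by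
  have hm : Measurable fun p : Space d × ℝ => k (p.1 + p.2 • z) :=
    hk.comp (measurable_fst.add (measurable_snd.smul_const z))
  rw [lintegral_lintegral_swap hm.aemeasurable]
  have : ∀ s : ℝ, ∫⁻ x, k (x + s • z) = ∫⁻ x, k x := fun s =>
    lintegral_add_right_eq_self k (s • z)
  simp [this]

/-- The bond energy of a fixed bond vector grows at most linearly in the length of the bond. -/
theorem exists_lintegral_potential_le (hd : 2 ≤ d) (hDopen : IsOpen D)
    (hDbdd : Bornology.IsBounded D) (ha : 0 < a) (hf : IsCohesivePotential f) {w : L20 D a}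
    (hw : HasFiniteLEFMEnergy D (toField w)) :
    ∃ C : ℝ, 0 ≤ C ∧ ∀ z : Space d, z ≠ 0 →
      ∫⁻ x, ENNReal.ofReal (f (‖z‖ * bondStrain (toField w) (x + z) x ^ 2)) ≤
        ENNReal.ofReal (C * ‖z‖) := by
  obtain ⟨e, g, K, hem, he2, hei, hKm, hKH, hgi, hid⟩ := hw.exists_strain hDopen hDbdd ha
  obtain ⟨N, hN0, hN⟩ := hf.exists_bound
  set μ : Measure (Space d) := (Measure.hausdorffMeasure ((d : ℝ) - 1)).restrict K with hμ
  have hμf : IsFiniteMeasure μ := ⟨by rwa [hμ, Measure.restrict_apply_univ]⟩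
  set H : ℝ := (Measure.hausdorffMeasure ((d : ℝ) - 1) K).toReal with hH
  have hHe : Measure.hausdorffMeasure ((d : ℝ) - 1) K = ENNReal.ofReal H :=
    (ENNReal.ofReal_toReal hKH.ne).symm
  have hH0 : 0 ≤ H := ENNReal.toReal_nonneg
  set b : Space d → ℝ := fun x => ∑ p : Fin d × Fin d, e x p.1 p.2 ^ 2 with hb
  have hbm : Measurable b := Finset.measurable_sum _ fun p _ => (hem p.1 p.2).pow_const 2
  have hbi : Integrable b := integrable_finsetSum _ fun p _ => (he2 p.1 p.2).integrable_sq
  have hb0 : ∀ x, 0 ≤ b x := fun x => Finset.sum_nonneg fun p _ => sq_nonneg _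
  have hE0 : 0 ≤ ∫ x, b x := integral_nonneg hb0
  have hc0 := hf.slope_zero_pos.le
  have hS0 := sweepConst_nonneg (d := d)
  set c := potentialSlope f 0 with hc
  -- The first term is the bulk contribution off the swept set, the second the bound `N` times the
  -- volume around the swept set.
  refine ⟨c * (∫ x, b x) + N * ((sweepConst d + 1) * (H + 1)), by positivity, fun z hz => ?_⟩
  have hr : 0 < ‖z‖ := norm_pos_iff.2 hz
  -- Raising `sweepConst d` by one makes the volume bound strict, which leaves room for an open
  -- neighborhood.
  obtain ⟨G, hKG, hGo, hG⟩ := (sweep z K).exists_isOpen_lt_of_lt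
    (ENNReal.ofReal ((sweepConst d + 1) * (H + 1) * ‖z‖)) (by
      refine (volume_sweep_le hd hz hKH).trans_lt ?_
      rw [hHe, ← ENNReal.ofReal_one, ← ENNReal.ofReal_add hH0 zero_le_one,
        ← ENNReal.ofReal_mul (by positivity), ENNReal.ofReal_lt_ofReal_iff (by positivity)]
      have : 0 < (H + 1) * ‖z‖ := by positivity
      linarith)
  set h : Space d → ℝ := fun x => ∑ p : Fin d × Fin d, z p.1 * z p.2 * e x p.1 p.2 with hh
  have hhm : Measurable h := Finset.measurable_sum _ fun p _ => (hem p.1 p.2).const_mul _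
  have hhi : Integrable h := integrable_finsetSum _ fun p _ => (hei p.1 p.2).const_mul _
  have hwi := integrable_toField hDopen hDbdd w
  have hγ : Integrable (fun y => ∑ p : Fin d × Fin d, z p.1 * z p.2 * g y p.1 p.2) μ :=
    integrable_finsetSum _ fun p _ => (hgi p.1 p.2).const_mul _
  have hae := ae_difference_eq_integral (v := fun x => ⟪toField w x, z⟫) (hwi.inner_const z) hhm
    hhi hγ (fun φ hφ hφc => integral_inner_mul_fderiv hwi hei hgi hid z hφ hφc)
    (ae_restrict_mem hKm) hGo (fun y hy s hs => hKG ⟨y, hy, s, hs, rfl⟩)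
  have hbm' : Measurable fun x => ENNReal.ofReal (c * ‖z‖ * b x) :=
    (hbm.const_mul _).ennreal_ofReal
  have hpt : ∀ᵐ x, ENNReal.ofReal (f (‖z‖ * bondStrain (toField w) (x + z) x ^ 2)) ≤
      (∫⁻ s in Ioc (0 : ℝ) 1, ENNReal.ofReal (c * ‖z‖ * b (x + s • z))) +
        G.indicator (fun _ => ENNReal.ofReal N) x := by
    filter_upwards [hae] with x hx
    by_cases hxG : x ∈ G
    · rw [indicator_of_mem hxG]
      exact (ENNReal.ofReal_le_ofReal (hN _ (by positivity))).trans le_add_self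
    · refine le_trans ?_ le_self_add
      have hprob : IsProbabilityMeasure (volume.restrict (Ioc (0 : ℝ) 1)) := ⟨by simp⟩
      have h1 := hx hxG
      have h2 : bondStrain (toField w) (x + z) x =
          (‖z‖ ^ 2)⁻¹ * ∫ s in Ioc (0 : ℝ) 1, h (x + s • z) := by
        rw [bondStrain, add_sub_cancel_left, real_inner_smul_left, real_inner_smul_right,
          inner_sub_left, h1]
        field_simp
      -- Powers of `‖z‖`: here `‖z‖⁻³`, and `h² ≤ ‖z‖⁴ b` below, so a single factor `‖z‖` remains.
      have h3 : f (‖z‖ * bondStrain (toField w) (x + z) x ^ 2) ≤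
          c * (‖z‖ ^ 3)⁻¹ * (∫ s in Ioc (0 : ℝ) 1, h (x + s • z)) ^ 2 := by
        refine (hf.le_slope_mul (by positivity)).trans_eq ?_
        rw [h2, ← hc]
        field_simp
      calc _ ≤ ENNReal.ofReal (c * (‖z‖ ^ 3)⁻¹) *
            ENNReal.ofReal ((∫ s in Ioc (0 : ℝ) 1, h (x + s • z)) ^ 2) := by
            rw [← ENNReal.ofReal_mul (by positivity)]
            exact ENNReal.ofReal_le_ofReal h3
        _ ≤ ENNReal.ofReal (c * (‖z‖ ^ 3)⁻¹) *
            ∫⁻ s in Ioc (0 : ℝ) 1, ENNReal.ofReal (h (x + s • z) ^ 2) := by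
            gcongr
            exact ofReal_sq_integral_le (hhm.comp (by fun_prop))
        _ = ∫⁻ s in Ioc (0 : ℝ) 1, ENNReal.ofReal (c * (‖z‖ ^ 3)⁻¹) *
            ENNReal.ofReal (h (x + s • z) ^ 2) :=
            (lintegral_const_mul' _ _ ENNReal.ofReal_ne_top).symm
        _ ≤ _ := by
            refine lintegral_mono fun s => ?_
            rw [← ENNReal.ofReal_mul (by positivity)]
            refine ENNReal.ofReal_le_ofReal ?_
            calc _ ≤ c * (‖z‖ ^ 3)⁻¹ * (‖z‖ ^ 4 * b (x + s • z)) := by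
                  gcongr
                  exact sq_sum_mul_le z (e (x + s • z))
              _ = _ := by field_simp
  calc _ ≤ ∫⁻ x, ((∫⁻ s in Ioc (0 : ℝ) 1, ENNReal.ofReal (c * ‖z‖ * b (x + s • z))) +
        G.indicator (fun _ => ENNReal.ofReal N) x) := lintegral_mono_ae hpt
    _ = (∫⁻ x, ENNReal.ofReal (c * ‖z‖ * b x)) + ENNReal.ofReal N * volume G := by
        rw [lintegral_add_right _ (measurable_const.indicator hGo.measurableSet),
          lintegral_prod_segment hbm', lintegral_indicator_const hGo.measurableSet]
    _ ≤ ENNReal.ofReal (c * ‖z‖ * ∫ x, b x) + ENNReal.ofReal N *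
        ENNReal.ofReal ((sweepConst d + 1) * (H + 1) * ‖z‖) := by
        refine add_le_add (le_of_eq ?_) (mul_le_mul_right hG.le _)
        rw [← integral_const_mul, ofReal_integral_eq_lintegral_ofReal (hbi.const_mul _)
          (Eventually.of_forall fun x => mul_nonneg (by positivity) (hb0 x))]
    _ = _ := by
        rw [← ENNReal.ofReal_mul hN0.le, ← ENNReal.ofReal_add (by positivity) (by positivity)]
        congr 1
        ring

/-- The peridynamic energies of a displacement with finite energy of linear elastic fracture
mechanics are bounded uniformly in the horizon. -/
theorem exists_pdEnergy_le (hd : 2 ≤ d) (hDopen : IsOpen D) (hDbdd : Bornology.IsBounded D)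
    (ha : 0 < a) (hf : IsCohesivePotential f) (hJ : IsInfluenceFunction d J) {w : L20 D a}
    (hw : HasFiniteLEFMEnergy D (toField w)) :
    ∃ E : ℝ, 0 ≤ E ∧ ∀ ε : ℝ, 0 < ε → (volume.real (Metric.ball (0 : Space d) ε))⁻¹ *
      pdEnergy f J ε (toField w) ≤ E := by
  obtain ⟨M, hM0, hM⟩ := hJ.exists_bound
  obtain ⟨C, hC0, hC⟩ := exists_lintegral_potential_le hd hDopen hDbdd ha hf hw
  refine ⟨M * C, by positivity, fun ε hε => ?_⟩
  have hV : 0 < volume.real (Metric.ball (0 : Space d) ε) :=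
    ENNReal.toReal_pos (Metric.measure_ball_pos _ _ hε).ne' measure_ball_lt_top.ne
  have hwm := measurable_toField w
  have hi := integrable_bondEnergy hd hf hJ.measurable hM hJ.eq_zero hε hwm
    (integrable_norm_sq_toField w)
  have hm : Measurable fun p => ENNReal.ofReal (bondEnergy f J ε (toField w) p) :=
    (measurable_bondEnergy hf hJ.measurable hwm).ennreal_ofReal
  rw [inv_mul_le_iff₀ hV, ← ENNReal.ofReal_le_ofReal_iff (by positivity), pdEnergy,
    ofReal_integral_eq_lintegral_ofReal hi
      (Eventually.of_forall fun p => bondEnergy_nonneg hf hM hε _ p),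
    lintegral_prod _ hm.aemeasurable]
  -- In terms of center and bond vector `z`, the weight depends on `z` alone. The linear growth in
  -- `‖z‖ < ε` absorbs the factor `1 / ε`, and the volume of the ball of bond vectors cancels the
  -- normalization.
  have hshift : ∀ x : Space d, ∫⁻ y, ENNReal.ofReal (bondEnergy f J ε (toField w) (x, y)) =
      ∫⁻ z, ENNReal.ofReal (bondEnergy f J ε (toField w) (x, x + z)) := fun x =>
    (lintegral_add_left_eq_self
      (fun y => ENNReal.ofReal (bondEnergy f J ε (toField w) (x, y))) x).symm
  simp only [hshift]
  have hm' : Measurable fun p : Space d × Space d =>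
      ENNReal.ofReal (bondEnergy f J ε (toField w) (p.1, p.1 + p.2)) :=
    hm.comp (measurable_fst.prodMk (measurable_fst.add measurable_snd))
  rw [lintegral_lintegral_swap hm'.aemeasurable]
  have hz : ∀ z : Space d, ∫⁻ x, ENNReal.ofReal (bondEnergy f J ε (toField w) (x, x + z)) ≤
      (Metric.ball (0 : Space d) ε).indicator (fun _ => ENNReal.ofReal (M * C)) z := by
    intro z
    have hk0 := weight_nonneg hM hε z
    have hsplit : ∀ x, ENNReal.ofReal (bondEnergy f J ε (toField w) (x, x + z)) =
        ENNReal.ofReal (1 / ε * J (‖z‖ / ε)) *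
          ENNReal.ofReal (f (‖z‖ * bondStrain (toField w) (x + z) x ^ 2)) := by
      intro x
      rw [← ENNReal.ofReal_mul hk0, bondEnergy]
      simp only [add_sub_cancel_left]
    simp only [hsplit]
    rw [lintegral_const_mul' _ _ ENNReal.ofReal_ne_top]
    by_cases hzε : z ∈ Metric.ball (0 : Space d) ε
    · rw [indicator_of_mem hzε]
      rcases eq_or_ne z 0 with rfl | hz0
      · simp [hf.map_zero]
      · refine (mul_le_mul_right (hC z hz0) _).trans ?_
        rw [← ENNReal.ofReal_mul hk0]
        refine ENNReal.ofReal_le_ofReal ?_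
        rw [mem_ball_zero_iff] at hzε
        have hJz := hM (‖z‖ / ε) (by positivity)
        calc 1 / ε * J (‖z‖ / ε) * (C * ‖z‖) = J (‖z‖ / ε) * (C * (‖z‖ / ε)) := by ring
          _ ≤ M * (C * 1) := by
            gcongr
            · exact hJz.2
            · exact (div_le_one hε).2 hzε.le
          _ = M * C := by ring
    · rw [indicator_of_notMem hzε]
      rw [mem_ball_zero_iff, not_lt] at hzε
      simp [hJ.eq_zero _ ((one_le_div hε).2 hzε)]
  refine (lintegral_mono hz).trans_eq ?_
  rw [lintegral_indicator_const measurableSet_ball, mul_comm,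
    ENNReal.ofReal_mul measureReal_nonneg, Measure.real,
    ENNReal.ofReal_toReal measure_ball_lt_top.ne]

end InitialEnergy

end CohesiveDynamics

end

open CohesiveDynamics
theorem mainTheorem5 {d : ℕ} (hd : d = 2 ∨ d = 3)
    (D : Set (Space d)) (hDopen : IsOpen D) (hDbdd : Bornology.IsBounded D)
    (a ρ T : ℝ) (ha : 0 < a) (hρ : 0 < ρ) (hT : 0 < T)
    (f J : ℝ → ℝ) (hf : IsCohesivePotential f) (hJ : IsInfluenceFunction d J)
    (rBar : ℝ) (hr : IsInflectionPoint f rBar)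
    (b : ℝ → L20 D a) (hb : ContDiffOn ℝ 1 b (Icc 0 T))
    (u₀ v₀ : L20 D a) (hu₀ : HasFiniteLEFMEnergy D (toField u₀))
    (u : ℕ → ℝ → L20 D a)
    (hu : ∀ k : ℕ, 1 ≤ k → 2 * horizon k < a →
      IsCohesiveEvolution D a ρ T f J b u₀ v₀ (horizon k) (u k))
    (κ α θ : ℝ) (hκ : 0 < κ) (hκr : κ ≤ rBar) (hα : 1 / 2 ≤ α) (hα1 : α < 1)
    (hθ : 0 < θ) (hθ1 : θ ≤ 1) :
    -- the sets decrease as `δ` decreases to zero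
    (∀ t ∈ Icc 0 T, ∀ δ δ' : ℝ, 0 < δ → δ ≤ δ' →
      CPZ D J κ α θ (fun k => toField (u k t)) δ ⊆ CPZ D J κ α θ (fun k => toField (u k t)) δ') ∧
    -- their volume is at most `K δ^(1-β)` with `β = 2α - 1`
    (∃ K : ℝ, 0 < K ∧ ∀ t ∈ Icc 0 T, ∀ δ : ℝ, 0 < δ →
      volume (CPZ D J κ α θ (fun k => toField (u k t)) δ) ≤
        ENNReal.ofReal (K * δ ^ (1 - (2 * α - 1)))) ∧
    ∀ t ∈ Icc 0 T,
      -- the volume of the limit set is the limit of the volumes, and is zero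
      Tendsto (fun δ : ℝ => volume (CPZ D J κ α θ (fun k => toField (u k t)) δ)) (𝓝[>] 0)
        (𝓝 (volume (CPZzero D J κ α θ (fun k => toField (u k t))))) ∧
      volume (CPZzero D J κ α θ (fun k => toField (u k t))) = 0 ∧
      -- the centers with controlled strain for all small horizons have full measure
      volume (D \ controlledCenters D J κ α θ (fun k => toField (u k t))) = 0 ∧
      volume (D \ CPZzero D J κ α θ (fun k => toField (u k t))) = volume D := by
  have hd2 : 2 ≤ d := by omega
  have hγ : 0 < 1 - (2 * α - 1) := by linarith
  have hbound : ∃ K : ℝ, 0 < K ∧ ∀ t ∈ Icc 0 T, ∀ δ : ℝ, 0 < δ →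
      volume (CPZ D J κ α θ (fun k => toField (u k t)) δ) ≤
        ENNReal.ofReal (K * δ ^ (1 - (2 * α - 1))) := by
    obtain ⟨E₀, hE₀, hE⟩ := exists_pdEnergy_le hd2 hDopen hDbdd ha hf hJ hu₀
    obtain ⟨B, hB⟩ := isCompact_Icc.exists_bound_of_continuousOn hb.continuousOn
    set E := gronwallBound (ρ / 2 * ‖v₀‖ ^ 2 + E₀) (1 / ρ) (B ^ 2 / 2) T with hEdef
    have hEpos : 0 ≤ E := by
      have h0 : 0 ≤ ρ / 2 * ‖v₀‖ ^ 2 + E₀ := by positivity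
      have h1 := gronwallBound_mono h0 (by positivity : 0 ≤ B ^ 2 / 2)
        (by positivity : 0 ≤ 1 / ρ) hT.le
      rw [gronwallBound_x0] at h1
      exact h0.trans h1
    have hfκ : 0 < f (κ ^ 2) := hf.pos _ (by positivity)
    have hm := hJ.mass_pos
    set C := volume.real (Metric.ball (0 : Space d) 1) * E /
      (f (κ ^ 2) * θ * influenceMass d J) with hC
    have hC0 : 0 ≤ C := by positivity
    have hq1 : (1 / 2 : ℝ) ^ (1 - (2 * α - 1)) < 1 :=
      Real.rpow_lt_one (by norm_num) (by norm_num) hγ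
    set K₁ := C / (1 - (1 / 2 : ℝ) ^ (1 - (2 * α - 1))) with hK₁
    have hK₁0 : 0 ≤ K₁ := div_nonneg hC0 (sub_nonneg.2 hq1.le)
    -- For `δ > a / 2` some horizons may violate `2 ε_k < a`, where nothing is known about `u k`;
    -- the trivial bound by the volume of `D` is used there. The `+ 1` in the final constant makes
    -- it positive.
    set K₂ := volume.real D / (a / 2) ^ (1 - (2 * α - 1)) with hK₂
    have hK₂0 : 0 ≤ K₂ := by positivity
    refine ⟨K₁ + K₂ + 1, by positivity, fun t ht δ hδ => ?_⟩
    have hδγ : 0 < δ ^ (1 - (2 * α - 1)) := Real.rpow_pos_of_pos hδ _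
    rcases le_or_gt δ (a / 2) with hδa | hδa
    · refine (volume_CPZ_le hC0 hγ hδ fun k hk hkδ => ?_).trans
        (ENNReal.ofReal_le_ofReal (by gcongr; linarith))
      have hev := hu k hk (by linarith)
      refine volume_processZone_le hd2 D hf hJ (horizon_pos k) (horizon_le_one k) hκ hα hα1 hθ
        (measurable_toField _) (integrable_norm_sq_toField _) ?_
      exact pdEnergy_le_gronwallBound hd2 hDopen hρ hT hf hJ (horizon_pos k) hev hB
        (by linarith [hE (horizon k) (horizon_pos k)]) ht
    · calc _ ≤ volume D := measure_mono CPZ_subset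
        _ = ENNReal.ofReal (volume.real D) :=
          (ENNReal.ofReal_toReal hDbdd.measure_lt_top.ne).symm
        _ ≤ _ := by
          refine ENNReal.ofReal_le_ofReal ?_
          calc volume.real D = K₂ * (a / 2) ^ (1 - (2 * α - 1)) := by
                rw [hK₂, div_mul_cancel₀]
                positivity
            _ ≤ (K₁ + K₂ + 1) * δ ^ (1 - (2 * α - 1)) := by
                gcongr
                linarith
  refine ⟨fun t _ δ δ' _ h => CPZ_mono h, hbound, fun t ht => ?_⟩
  obtain ⟨K, -, hK⟩ := hbound
  obtain ⟨hlim, hzero⟩ := tendsto_volume_CPZ hγ (hK t ht)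
  refine ⟨by rwa [hzero], hzero, ?_, measure_sdiff_null hzero⟩
  exact measure_mono_null
    (diff_controlledCenters_subset hJ fun k => measurable_toField (u k t)) hzero
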